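/- A subshift over a finite alphabet $A$ is a closed set $X\subset A^{\mathbb N}$ (one-sided) or $X\subset A^{\mathbb Z}$ (two-sided) that is invariant under the shift $(\sigma x)_n=x_{n+1}$ (with $\sigma(X)\subset X$ in the one-sided case and $\sigma(X)=X$ in the two-sided case). A subshift factor of a subshift $X$ is a subshift $Y$ over a finite alphabet, one-sided or two-sided as $X$ is, for which there is a continuous surjection $\pi\colon X\to Y$ with $\pi\circ\sigma=\sigma\circ\pi$. A measure of maximal entropy of $Y$ is a $\sigma$-invariant Borel probability measure on $Y$ that attains $\sup_\nu h_\nu(\sigma)$, the supremum of the Kolmogorov–Sinai entropies of the $\sigma$-invariant Borel probability measures $\nu$ on $Y$. For a real number $\beta>1$, the one-sided $\beta$-shift is the closure, in $\{0,\dots,\lceil\beta\rceil\}^{\mathbb N}$, of the set of sequences $(\lfloor \beta f_\beta^n(t)\rfloor)_{n\ge 0}$, $t\in[0,1)$, where $f_\beta(t)=\beta t \bmod 1$; the two-sided $\beta$-shift is the set of bi-infinite sequences all of whose right tails $(x_{i+n})_{n\ge0}$, $i\in\mathbb Z$, belong to it. For an infinite set $S\subset\{0,1,2,\dots\}$, the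 two-sided (one-sided) $S$-gap shift is the set of sequences in $\{0,1\}^{\mathbb Z}$ (in $\{0,1\}^{\mathbb N}$) in which the number of $0$'s between any two consecutive $1$'s is an element of $S$. **Theorem A.** Let $X$ be a $\beta$-shift ($\beta>1$) or an $S$-gap shift ($S$ infinite), one-sided or two-sided, and let $Y$ be a subshift factor of $X$. Then $Y$ is intrinsically ergodic, that is, it has exactly one measure of maximal entropy $\mu$. Moreover, for every $n\ge1$ the set $\mathrm{Per}(n)=\{y\in Y \mid \sigma^k(y)=y \text{ for some } 1\le k\le n\}$ is finite and nonempty, and the probability measures $$\mu_n=\frac1{\#\mathrm{Per}(n)}\sum_{y\in\mathrm{Per}(n)}\delta_y$$ converge to $\mu$ in the weak* topology as $n\to\infty$. -/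

import Mathlib

open MeasureTheory Filter Topology Set SymbolicDynamics.FullShift
open scoped ENNReal


/-! ### Entropy and measures of maximal entropy of a measurable map -/

section Entropy

variable {Ω : Type*} [MeasurableSpace Ω]

/-- The Shannon entropy (natural logarithm) of the join of `ξ, T⁻¹ξ, …, T⁻⁽ⁿ⁻¹⁾ξ`, where the finite
partition `ξ` is given by its labelling map `Ω → Fin k`. -/
noncomputable def joinEntropy (T : Ω → Ω) (μ : Measure Ω) {k : ℕ} (ξ : Ω → Fin k) (n : ℕ) : ℝ :=
  ∑ w : Fin n → Fin k, Real.negMulLog (μ.real {x | ∀ i : Fin n, ξ (T^[i] x) = w i})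

/-- The entropy of `T` with respect to the finite partition `ξ`. For an invariant probability
measure the upper limit is a limit, by subadditivity. -/
noncomputable def partitionEntropy (T : Ω → Ω) (μ : Measure Ω) {k : ℕ} (ξ : Ω → Fin k) : EReal :=
  limsup (fun n : ℕ => ((joinEntropy T μ ξ n / n : ℝ) : EReal)) atTop

/-- The Kolmogorov–Sinai entropy `h_μ(T)`: the supremum over all finite measurable partitions. -/
noncomputable def measureEntropy (T : Ω → Ω) (μ : Measure Ω) : EReal :=
  ⨆ (k : ℕ) (ξ : Ω → Fin k) (_ : Measurable ξ), partitionEntropy T μ ξ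

/-- `μ` is a measure of maximal entropy: an invariant probability measure that attains
`sup {h_ν(T) | ν an invariant probability measure}`. -/
def IsMME (T : Ω → Ω) (μ : ProbabilityMeasure Ω) : Prop :=
  MeasurePreserving T (μ : Measure Ω) μ ∧
    ∀ ν : ProbabilityMeasure Ω, MeasurePreserving T (ν : Measure Ω) ν →
      measureEntropy T (ν : Measure Ω) ≤ measureEntropy T (μ : Measure Ω)

/-- There is exactly one measure of maximal entropy. -/
def IntrinsicallyErgodic (T : Ω → Ω) : Prop :=
  ∃! μ : ProbabilityMeasure Ω, IsMME T μ

/-- The set of periodic points of period at most `n`. -/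
def Per (T : Ω → Ω) (n : ℕ) : Set Ω :=
  {x | ∃ k : ℕ, 1 ≤ k ∧ k ≤ n ∧ Function.IsPeriodicPt T k x}

/-- The measure `(1 / #Per(n)) ∑_{x ∈ Per(n)} δ_x`. -/
noncomputable def perMeasure (T : Ω → Ω) (n : ℕ) : Measure Ω :=
  ((Per T n).ncard : ℝ≥0∞)⁻¹ • Measure.sum (fun x : Per T n => Measure.dirac (x : Ω))

/-- For every `n ≥ 1` the set `Per(n)` is finite and nonempty, so that the measure evenly
distributed on `Per(n)` is a probability measure, and these measures converge weak* to `μ`. -/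
def PerMeasuresConverge [TopologicalSpace Ω] [OpensMeasurableSpace Ω]
    (T : Ω → Ω) (μ : ProbabilityMeasure Ω) : Prop :=
  (∀ n : ℕ, 1 ≤ n → (Per T n).Finite ∧ (Per T n).Nonempty) ∧
    ∃ ν : ℕ → ProbabilityMeasure Ω,
      (∀ n : ℕ, 1 ≤ n → (ν n : Measure Ω) = perMeasure T n) ∧ Tendsto ν atTop (𝓝 μ)

end Entropy

/-! ### Subshifts and factors; one-sided shifts have index `ℕ`, two-sided ones `ℤ` -/

section Subshifts

variable {A B G : Type*} [TopologicalSpace A] [TopologicalSpace B] [AddMonoidWithOne G]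

/-- The shift map `(σ x)_n = x_{n+1}` on a subshift. -/
noncomputable def shiftMap (X : Subshift A G) : X.carrier → X.carrier :=
  (X.mapsTo 1).restrict (shift 1) X.carrier X.carrier

/-- `Y` is a (topological) factor of `X`. -/
def IsFactor (X : Subshift A G) (Y : Subshift B G) : Prop :=
  ∃ π : X.carrier → Y.carrier, Continuous π ∧ Function.Surjective π ∧
    ∀ x, π (shiftMap X x) = shiftMap Y (π x)

/-- The two-sided shift associated with a one-sided shift `X`: all bi-infinite sequences all of
whose right tails lie in `X`. -/
noncomputable def twoSided (X : Subshift A ℕ) : Subshift A ℤ where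
  carrier := {x | ∀ i : ℤ, (fun n : ℕ => x (i + n)) ∈ X.carrier}
  isClosed := by
    simp only [ofPred_forall]
    refine isClosed_iInter fun i => ?_
    have hc : Continuous fun (x : ℤ → A) (n : ℕ) => x (i + n) :=
      continuous_pi fun n => continuous_apply _
    exact X.isClosed.preimage hc
  mapsTo := by
    intro g x hx i
    simpa only [shift_apply, add_assoc] using hx (g + i)

end Subshifts

/-! ### β-shifts -/

/-- The `β`-transformation `t ↦ βt (mod 1)`. -/
noncomputable def betaMap (β t : ℝ) : ℝ := Int.fract (β * t)

/-- The `β`-expansions of the points `t ∈ [0,1)`: the `n`-th digit is `⌊β f_β^n(t)⌋`. -/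
def betaExpansions (β : ℝ) : Set (ℕ → Fin (⌈β⌉₊ + 1)) :=
  {x | ∃ t ∈ Ico (0 : ℝ) 1, ∀ n : ℕ, (x n : ℕ) = ⌊β * (betaMap β)^[n] t⌋₊}

/-- The (one-sided) `β`-shift: the closure of the set of `β`-expansions of points of `[0,1)`. -/
noncomputable def betaShift (β : ℝ) : Subshift (Fin (⌈β⌉₊ + 1)) ℕ where
  carrier := closure (betaExpansions β)
  isClosed := isClosed_closure
  mapsTo := by
    intro g
    refine MapsTo.closure ?_ (continuous_shift g)
    rintro x ⟨t, ht, hx⟩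
    refine ⟨(betaMap β)^[g] t, ?_, fun n => ?_⟩
    · cases g with
      | zero => exact ht
      | succ g =>
        rw [Function.iterate_succ_apply']
        exact ⟨Int.fract_nonneg _, Int.fract_lt_one _⟩
    · rw [shift_apply, hx, add_comm, Function.iterate_add_apply]

/-! ### S-gap shifts -/

/-- The `S`-gap shift over the index set `G` (`ℤ`: two-sided, `ℕ`: one-sided): all 0-1 sequences
in which the number of `0`s between consecutive `1`s belongs to `S`. -/
noncomputable def sGapShift (G : Type*) [AddMonoidWithOne G] (S : Set ℕ) : Subshift (Fin 2) G where
  carrier := {x | ∀ (g : G) (n : ℕ), x g = 1 → (∀ i : ℕ, i < n → x (g + (i + 1 : ℕ)) = 0) →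
    x (g + (n + 1 : ℕ)) = 1 → n ∈ S}
  isClosed := by
    simp only [ofPred_forall]
    refine isClosed_iInter fun g => isClosed_iInter fun n => ?_
    have hc : ∀ (h : G) (a : Fin 2), IsOpen {x : G → Fin 2 | x h = a} := fun h a => by
      have he : Continuous fun x : G → Fin 2 => x h := continuous_apply h
      exact (isOpen_discrete ({a} : Set (Fin 2))).preimage he
    refine isClosed_imp (hc _ _) (isClosed_imp ?_ (isClosed_imp (hc _ _) isClosed_const))
    simp only [ofPred_forall]
    exact (finite_lt_nat n).isOpen_biInter fun i _ => hc _ _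
  mapsTo := by
    intro h x hx g n h1 h2 h3
    simp only [shift_apply, ← add_assoc] at h1 h2 h3
    exact hx (h + g) n h1 h2 h3

/-! Every word of a β-shift or an S-gap shift has the form `0^i v (s k)`: one possible prefix and
one possible suffix for each length, around a core `v` from a set `G` closed under concatenation
whose nonempty elements can be repeated periodically. For β-shifts `G` consists of the words whose
cylinder is mapped onto all of `[0,1)`, and `s k` is the beginning of the quasi-greedy expansion of
`1`. For S-gap shifts `G` consists of the products of blocks `1 0^n` with `n ∈ S`, and `s k = 1
0^(k-1)`. A factor map is a sliding block code, so the labels of a factor `Y` inherit this structure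
up to the windows that cross a seam (`CodedShift`, `CodedSystem`,
`intrinsicallyErgodic_of_isFactor`).

Let `h` be the growth rate of the words of `Y`. Code images of core words are supermultiplicative in
number, so those of length `m` number at most `exp (m h)`. If `h > 0`, summing over prefix and
suffix lengths is a geometric series and gives at most `C exp (n h)` words of length `n`
(`exists_wordCount_le`). Conversely, any positive fraction of these words contains a positive
fraction with bounded prefix and suffix, extendable to words of `G` of one common length
(`exists_good_subset`). Gluing such words into periodic points shows that `#Per(N)` is comparable to
`exp (N h)`, and that a positive fraction of `Per(N)` meets two prescribed large sets of words at
prescribed times (`exists_le_ncard_per_two`).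

Let `μ` be a weak* limit of the periodic-orbit measures along any filter finer than `atTop`.
Counting gives `μ[w] ≤ C exp (-m h)` for every word `w` of length `m`, so `μ` has entropy at least
`h`, the largest possible value. For a measure `ρ` of maximal entropy, a set of words of `ρ`-measure
at least `a` is a positive fraction of all words, uniformly in the length. With the gluing estimate
this yields `μ(E₁ ∩ T^{-k} E₂) > 0` for some `k` whenever `ρ₁(E₁)` and `ρ₂(E₂)` are positive for
measures `ρ₁`, `ρ₂` of maximal entropy (`exists_measureReal_inter_pos`). Hence `μ` is ergodic and `ρ
≪ μ`, so `ρ = μ`. All limits therefore coincide, and compactness turns this into convergence. If `h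
= 0`, the labels are constant and `Y` is a point. -/

/-! ### Shannon entropy of finite-valued maps -/

section LabelEntropy

/-- The Shannon entropy of the partition of `Ω` into the fibres of `f`. -/
noncomputable def labelEntropy {Ω ι : Type*} [MeasurableSpace Ω] [Fintype ι] (μ : Measure Ω)
    (f : Ω → ι) : ℝ :=
  ∑ i, Real.negMulLog (μ.real (f ⁻¹' {i}))

/-- The first `n` labels along the `T`-orbit of `x`. -/
def itinerary {Ω ι : Type*} (T : Ω → Ω) (f : Ω → ι) (n : ℕ) (x : Ω) : Fin n → ι :=
  fun i => f (T^[i] x)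

theorem itinerary_eq_iff {Ω ι : Type*} {T : Ω → Ω} {f : Ω → ι} {n : ℕ} {x y : Ω} :
    itinerary T f n x = itinerary T f n y ↔ ∀ i < n, f (T^[i] x) = f (T^[i] y) :=
  ⟨fun h i hi => congrFun h ⟨i, hi⟩, fun h => funext fun i => h i i.2⟩

/-- This is `log s ≤ s - 1` at `s = q / p`, multiplied by `p`. The defects `q - p` sum to at most
zero in Gibbs' inequality. The hypothesis `h` keeps the junk value `log 0 = 0` out. -/
theorem Real.negMulLog_le_neg_mul_log_add {p q : ℝ} (hp : 0 ≤ p) (hq : 0 ≤ q)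
    (h : q = 0 → p = 0) : Real.negMulLog p ≤ -(p * Real.log q) + (q - p) := by
  rcases hp.eq_or_lt with rfl | hp
  · simpa using hq
  have hq' : 0 < q := hq.lt_of_ne fun h0 => hp.ne' (h h0.symm)
  have h1 := Real.log_le_sub_one_of_pos (div_pos hq' hp)
  rw [Real.log_div hq'.ne' hp.ne'] at h1
  have h2 := mul_le_mul_of_nonneg_left h1 hp.le
  have h3 : p * (q / p - 1) = q - p := by field_simp
  rw [h3] at h2
  rw [Real.negMulLog]
  linarith

theorem measurable_itinerary {Ω ι : Type*} [MeasurableSpace Ω] [MeasurableSpace ι] {T : Ω → Ω}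
    {f : Ω → ι} (hT : Measurable T) (hf : Measurable f) (n : ℕ) :
    Measurable (itinerary T f n) :=
  measurable_pi_lambda _ fun i => hf.comp (hT.iterate i)

theorem preimage_prodMk_singleton {Ω ι κ : Type*} {f : Ω → ι} {g : Ω → κ} (i : ι) (j : κ) :
    (fun x => (f x, g x)) ⁻¹' {(i, j)} = f ⁻¹' {i} ∩ g ⁻¹' {j} := by
  ext x; simp

variable {Ω ι κ : Type*} [MeasurableSpace Ω] [Fintype ι] [Fintype κ] [MeasurableSpace ι]
  [MeasurableSpace κ] [MeasurableSingletonClass ι] [MeasurableSingletonClass κ]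
  {μ : Measure Ω} {f : Ω → ι} {g : Ω → κ} {T : Ω → Ω}

theorem measureReal_eq_sum_inter_preimage [IsFiniteMeasure μ] (hg : Measurable g) {s : Set Ω}
    (hs : MeasurableSet s) : μ.real s = ∑ j, μ.real (s ∩ g ⁻¹' {j}) := by
  have h : s = ⋃ j ∈ (Finset.univ : Finset κ), s ∩ g ⁻¹' {j} := by ext x; simp
  conv_lhs => rw [h]
  refine measureReal_biUnion_finset (fun i _ j _ hij => Set.disjoint_left.2 ?_)
    fun j _ => hs.inter (hg (measurableSet_singleton j))
  rintro x ⟨_, hx⟩ ⟨_, hx'⟩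
  exact hij (by rw [← (show g x = i from hx), ← (show g x = j from hx')])

theorem sum_measureReal_preimage_singleton [IsProbabilityMeasure μ] (hf : Measurable f) :
    ∑ i, μ.real (f ⁻¹' {i}) = 1 := by
  simpa using (measureReal_eq_sum_inter_preimage (μ := μ) hf MeasurableSet.univ).symm

/-- Gibbs' inequality. -/
theorem labelEntropy_le_neg_sum [IsProbabilityMeasure μ] (hf : Measurable f) {q : ι → ℝ}
    (hq : ∀ i, 0 ≤ q i) (h : ∀ i, q i = 0 → μ.real (f ⁻¹' {i}) = 0) (hsum : ∑ i, q i ≤ 1) :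
    labelEntropy μ f ≤ -∑ i, μ.real (f ⁻¹' {i}) * Real.log (q i) := by
  calc labelEntropy μ f
      ≤ ∑ i, (-(μ.real (f ⁻¹' {i}) * Real.log (q i)) + (q i - μ.real (f ⁻¹' {i}))) :=
        Finset.sum_le_sum fun i _ =>
          Real.negMulLog_le_neg_mul_log_add measureReal_nonneg (hq i) (h i)
    _ ≤ _ := by
        rw [Finset.sum_add_distrib, Finset.sum_sub_distrib, Finset.sum_neg_distrib,
          sum_measureReal_preimage_singleton hf]
        linarith

/-- Gibbs' inequality against the product of the two marginals. -/
theorem labelEntropy_prodMk_le [IsProbabilityMeasure μ] (hf : Measurable f) (hg : Measurable g) :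
    labelEntropy μ (fun x => (f x, g x)) ≤ labelEntropy μ f + labelEntropy μ g := by
  have hfm := fun i => hf (measurableSet_singleton i)
  have hgm := fun i => hg (measurableSet_singleton i)
  have h0 : ∀ i j, μ.real (f ⁻¹' {i}) * μ.real (g ⁻¹' {j}) = 0 →
      μ.real (f ⁻¹' {i} ∩ g ⁻¹' {j}) = 0 := by
    intro i j hij
    rcases mul_eq_zero.1 hij with h | h
    · exact measureReal_mono_null inter_subset_left h
    · exact measureReal_mono_null inter_subset_right h
  have hle := labelEntropy_le_neg_sum (μ := μ) (hf.prodMk hg)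
    (q := fun k => μ.real (f ⁻¹' {k.1}) * μ.real (g ⁻¹' {k.2}))
    (fun k => mul_nonneg measureReal_nonneg measureReal_nonneg)
    (fun k hk => by
      rw [← Prod.mk.eta (p := k), preimage_prodMk_singleton]
      exact h0 _ _ hk)
    (by
      rw [Fintype.sum_prod_type]
      simp only [← Finset.mul_sum, sum_measureReal_preimage_singleton hg, mul_one,
        sum_measureReal_preimage_singleton hf, le_refl])
  refine hle.trans (le_of_eq ?_)
  have hsplit : ∀ i j, μ.real (f ⁻¹' {i} ∩ g ⁻¹' {j}) *
      Real.log (μ.real (f ⁻¹' {i}) * μ.real (g ⁻¹' {j})) =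
      μ.real (f ⁻¹' {i} ∩ g ⁻¹' {j}) * Real.log (μ.real (f ⁻¹' {i})) +
      μ.real (g ⁻¹' {j} ∩ f ⁻¹' {i}) * Real.log (μ.real (g ⁻¹' {j})) := by
    intro i j
    rw [inter_comm (g ⁻¹' {j})]
    by_cases hij : μ.real (f ⁻¹' {i}) * μ.real (g ⁻¹' {j}) = 0
    · rw [h0 i j hij]; ring
    · rw [Real.log_mul (left_ne_zero_of_mul hij) (right_ne_zero_of_mul hij)]; ring
  rw [Fintype.sum_prod_type]
  simp only [preimage_prodMk_singleton, hsplit, Finset.sum_add_distrib, ← Finset.sum_mul]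
  rw [Finset.sum_comm (f := fun i j => μ.real (g ⁻¹' {j} ∩ f ⁻¹' {i}) *
    Real.log (μ.real (g ⁻¹' {j})))]
  simp only [← Finset.sum_mul, ← measureReal_eq_sum_inter_preimage hg (hfm _),
    ← measureReal_eq_sum_inter_preimage hf (hgm _), labelEntropy, Real.negMulLog, neg_mul,
    Finset.sum_neg_distrib]
  ring

/-- A map that is a function of `f` has at most the entropy of `f`. -/
theorem labelEntropy_le_of_factors [IsProbabilityMeasure μ] (hf : Measurable f)
    (h : ∀ x y, f x = f y → g x = g y) : labelEntropy μ g ≤ labelEntropy μ f := by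
  classical
  have hg : Measurable g := by
    refine measurable_to_countable' fun j => ?_
    have : g ⁻¹' {j} = f ⁻¹' (f '' (g ⁻¹' {j})) := by
      ext x
      refine ⟨fun hx => ⟨x, hx, rfl⟩, ?_⟩
      rintro ⟨y, hy, hyx⟩
      exact (h _ _ hyx).symm.trans hy
    rw [this]
    exact hf (Set.toFinite _).measurableSet
  have hfm := fun i => hf (measurableSet_singleton i)
  have hgm := fun i => hg (measurableSet_singleton i)
  unfold labelEntropy
  calc ∑ j, Real.negMulLog (μ.real (g ⁻¹' {j}))
      = ∑ j, ∑ i, -(μ.real (g ⁻¹' {j} ∩ f ⁻¹' {i}) * Real.log (μ.real (g ⁻¹' {j}))) := by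
        refine Finset.sum_congr rfl fun j _ => ?_
        rw [Finset.sum_neg_distrib, ← Finset.sum_mul,
          ← measureReal_eq_sum_inter_preimage hf (hgm j), Real.negMulLog, neg_mul]
    _ ≤ ∑ j, ∑ i, -(μ.real (f ⁻¹' {i} ∩ g ⁻¹' {j}) * Real.log (μ.real (f ⁻¹' {i}))) := by
        -- Where the two fibres meet, the fibre of `f` lies inside that of `g`, and `log` is
        -- monotone.
        refine Finset.sum_le_sum fun j _ => Finset.sum_le_sum fun i _ => neg_le_neg ?_
        rw [inter_comm (g ⁻¹' {j})]
        rcases (measureReal_nonneg (μ := μ) (s := f ⁻¹' {i} ∩ g ⁻¹' {j})).eq_or_lt with h0 | h0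
        · simp [← h0]
        have hne : (f ⁻¹' {i} ∩ g ⁻¹' {j}).Nonempty := by
          by_contra hne
          rw [not_nonempty_iff_eq_empty.1 hne, measureReal_empty] at h0
          exact h0.false
        obtain ⟨x, hx, hx'⟩ := hne
        have hsub : f ⁻¹' {i} ⊆ g ⁻¹' {j} := fun y hy =>
          (h y x ((show f y = i from hy).trans (show f x = i from hx).symm)).trans hx'
        refine mul_le_mul_of_nonneg_left (Real.log_le_log ?_ (measureReal_mono hsub)) h0.le
        exact h0.trans_le (measureReal_mono inter_subset_left)
    _ = ∑ i, Real.negMulLog (μ.real (f ⁻¹' {i})) := by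
        rw [Finset.sum_comm]
        refine Finset.sum_congr rfl fun i _ => ?_
        rw [Finset.sum_neg_distrib, ← Finset.sum_mul,
          ← measureReal_eq_sum_inter_preimage hg (hfm i), Real.negMulLog, neg_mul]

theorem labelEntropy_comp_iterate (hT : MeasurePreserving T μ μ) (hf : Measurable f) (n : ℕ) :
    labelEntropy μ (f ∘ T^[n]) = labelEntropy μ f := by
  unfold labelEntropy
  refine Finset.sum_congr rfl fun i _ => ?_
  rw [preimage_comp, (hT.iterate n).measureReal_preimage
    (hf (measurableSet_singleton i)).nullMeasurableSet]

theorem subadditive_labelEntropy_itinerary [IsProbabilityMeasure μ]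
    (hT : MeasurePreserving T μ μ) (hf : Measurable f) :
    Subadditive fun n => labelEntropy μ (itinerary T f n) := by
  intro m n
  have hm := measurable_itinerary hT.measurable hf m
  have hn := measurable_itinerary hT.measurable hf n
  calc labelEntropy μ (itinerary T f (m + n))
      ≤ labelEntropy μ (fun x => (itinerary T f m x, (itinerary T f n ∘ T^[m]) x)) := by
        refine labelEntropy_le_of_factors
          (hm.prodMk (hn.comp (hT.measurable.iterate m))) fun x y hxy => ?_
        rw [Prod.mk.injEq, Function.comp_apply, Function.comp_apply, itinerary_eq_iff,
          itinerary_eq_iff] at hxy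
        refine itinerary_eq_iff.2 fun i hi => ?_
        rcases lt_or_ge i m with him | him
        · exact hxy.1 i him
        · have := hxy.2 (i - m) (by omega)
          rwa [← Function.iterate_add_apply, ← Function.iterate_add_apply,
            Nat.sub_add_cancel him] at this
    _ ≤ labelEntropy μ (itinerary T f m) + labelEntropy μ (itinerary T f n ∘ T^[m]) :=
        labelEntropy_prodMk_le hm (hn.comp (hT.measurable.iterate m))
    _ = _ := by rw [labelEntropy_comp_iterate hT hn]

theorem labelEntropy_itinerary_le [IsProbabilityMeasure μ]
    (hT : MeasurePreserving T μ μ) (hf : Measurable f) (n : ℕ) :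
    labelEntropy μ (itinerary T f n) ≤ n * labelEntropy μ f := by
  have h1 : labelEntropy μ (itinerary T f 1) ≤ labelEntropy μ f :=
    labelEntropy_le_of_factors hf fun x y hxy => itinerary_eq_iff.2 fun i hi => by
      obtain rfl : i = 0 := by omega
      exact hxy
  have h0 : labelEntropy μ (itinerary T f 0) ≤ 0 := by
    simp [labelEntropy, preimage, eq_iff_true_of_subsingleton]
  have := (subadditive_labelEntropy_itinerary hT hf).apply_mul_add_le n 1 0
  rw [mul_one, add_zero] at this
  nlinarith [mul_le_mul_of_nonneg_left h1 (Nat.cast_nonneg (α := ℝ) n)]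

/-- A label that is constant up to a set of small measure has small entropy. -/
theorem exists_labelEntropy_le_of_measureReal_ge (ι : Type*) [Fintype ι] [MeasurableSpace ι]
    [MeasurableSingletonClass ι] (i₀ : ι) {ε : ℝ} (hε : 0 < ε) :
    ∃ δ > 0, ∀ (Ω : Type*) [MeasurableSpace Ω] (μ : Measure Ω) [IsProbabilityMeasure μ]
      (f : Ω → ι), Measurable f → μ.real {x | f x ≠ i₀} ≤ δ → labelEntropy μ f ≤ ε := by
  have hc : (0 : ℝ) < Fintype.card ι := by exact_mod_cast Fintype.card_pos_iff.2 ⟨i₀⟩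
  -- Each of the `card ι` terms is made at most `e`: `negMulLog` vanishes at `1`, which handles
  -- `i₀`, and at `0`, which handles every other value.
  set e := ε / Fintype.card ι with he
  have hepos : 0 < e := div_pos hε hc
  have h0 := Metric.continuous_iff.1 Real.continuous_negMulLog 0 e hepos
  have h1 := Metric.continuous_iff.1 Real.continuous_negMulLog 1 e hepos
  obtain ⟨d0, hd0, H0⟩ := h0
  obtain ⟨d1, hd1, H1⟩ := h1
  refine ⟨min d0 d1 / 2, by positivity, fun Ω _ μ _ f hf hμ => ?_⟩
  have hlt : μ.real {x | f x ≠ i₀} < min d0 d1 := hμ.trans_lt (half_lt_self (by positivity))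
  have hterm : ∀ i, Real.negMulLog (μ.real (f ⁻¹' {i})) ≤ e := by
    intro i
    by_cases hi : i = i₀
    · subst hi
      have hcompl : μ.real {x | f x ≠ i} = 1 - μ.real (f ⁻¹' {i}) := by
        rw [← probReal_compl_eq_one_sub (hf (measurableSet_singleton i))]; rfl
      have := H1 (μ.real (f ⁻¹' {i})) (by
        rw [Real.dist_eq, abs_sub_comm, abs_of_nonneg (sub_nonneg.2 measureReal_le_one), ← hcompl]
        exact hlt.trans_le (min_le_right _ _))
      rw [Real.negMulLog_one, Real.dist_eq, sub_zero] at this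
      exact (le_abs_self _).trans this.le
    · have hle : μ.real (f ⁻¹' {i}) ≤ μ.real {x | f x ≠ i₀} :=
        measureReal_mono fun x (hx : f x = i) => by simpa [hx] using hi
      have := H0 (μ.real (f ⁻¹' {i})) (by
        rw [Real.dist_eq, sub_zero, abs_of_nonneg measureReal_nonneg]
        exact hle.trans_lt (hlt.trans_le (min_le_left _ _)))
      rw [Real.negMulLog_zero, Real.dist_eq, sub_zero] at this
      exact (le_abs_self _).trans this.le
  calc labelEntropy μ f ≤ ∑ _i : ι, e := Finset.sum_le_sum fun i _ => hterm i
    _ = ε := by rw [Finset.sum_const, Finset.card_univ, nsmul_eq_mul, he]; field_simp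

theorem joinEntropy_eq_labelEntropy {k : ℕ} (ξ : Ω → Fin k) (n : ℕ) :
    joinEntropy T μ ξ n = labelEntropy μ (itinerary T ξ n) := by
  unfold joinEntropy labelEntropy
  refine Finset.sum_congr rfl fun w _ => ?_
  congr 2
  ext x
  exact ⟨fun h => funext h, fun h i => congrFun h i⟩

end LabelEntropy

/-! ### Generating labellings -/

section Generator

variable {Ω : Type*} {p : ℕ}

/-- The measurable sets `K` for which `T^N x ∈ K` can be read off the first `m` labels of `x`,
for some `N` and `m`. -/
def readableSets [MeasurableSpace Ω] (T : Ω → Ω) (α : Ω → Fin p) : Set (Set Ω) :=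
  {K | MeasurableSet K ∧ ∃ N m : ℕ, ∀ x y, itinerary T α m x = itinerary T α m y →
    (T^[N] x ∈ K ↔ T^[N] y ∈ K)}

variable {T : Ω → Ω} {α : Ω → Fin p} [mΩ : MeasurableSpace Ω]

/-- A reading delay can always be increased, at the price of equally many further labels. So a
finite family shares one delay, namely the sum of the individual ones. -/
theorem exists_forall_readable {ι : Type*} [Finite ι] {K : ι → Set Ω}
    (hK : ∀ i, K i ∈ readableSets T α) :
    ∃ N m : ℕ, ∀ i x y, itinerary T α m x = itinerary T α m y →
      (T^[N] x ∈ K i ↔ T^[N] y ∈ K i) := by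
  cases nonempty_fintype ι
  choose N m h using fun i => (hK i).2
  refine ⟨∑ i, N i, ∑ i, (N i + m i), fun i x y hxy => ?_⟩
  have hN : N i ≤ ∑ i, N i := Finset.single_le_sum (fun _ _ => Nat.zero_le _) (Finset.mem_univ i)
  have hM : ∑ i, N i + m i ≤ ∑ i, (N i + m i) := by
    rw [Finset.sum_add_distrib]
    gcongr
    exact Finset.single_le_sum (fun _ _ => Nat.zero_le _) (Finset.mem_univ i)
  obtain ⟨d, hd⟩ := Nat.exists_eq_add_of_le hN
  have := h i (T^[d] x) (T^[d] y) (itinerary_eq_iff.2 fun j hj => by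
    rw [← Function.iterate_add_apply, ← Function.iterate_add_apply]
    exact itinerary_eq_iff.1 hxy (j + d) (by omega))
  rwa [← Function.iterate_add_apply, ← Function.iterate_add_apply, ← hd] at this

/-- With a common delay, Boolean combinations can be read off pointwise. The ring structure makes
every measurable set approximable by readable ones. The delay lets finitely many labels at times `≥
0` describe a cylinder at negative coordinates. -/
theorem isSetRing_readableSets : IsSetRing (readableSets T α) where
  empty_mem := ⟨MeasurableSet.empty, 0, 0, fun _ _ _ => by simp⟩
  union_mem := by
    intro s t hs ht
    obtain ⟨N, m, h⟩ := exists_forall_readable (ι := Bool) (K := fun b => cond b s t)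
      (by rintro (_ | _); exacts [ht, hs])
    exact ⟨hs.1.union ht.1, N, m, fun x y hxy => or_congr (h true x y hxy) (h false x y hxy)⟩
  sdiff_mem := by
    intro s t hs ht
    obtain ⟨N, m, h⟩ := exists_forall_readable (ι := Bool) (K := fun b => cond b s t)
      (by rintro (_ | _); exacts [ht, hs])
    exact ⟨hs.1.diff ht.1, N, m, fun x y hxy =>
      and_congr (h true x y hxy) (not_congr (h false x y hxy))⟩

theorem univ_mem_readableSets : univ ∈ readableSets T α :=
  ⟨MeasurableSet.univ, 0, 0, fun _ _ _ => by simp⟩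

theorem exists_readable_symmDiff_lt {μ : Measure Ω} [IsFiniteMeasure μ]
    (hgen : mΩ = MeasurableSpace.generateFrom (readableSets T α)) {s : Set Ω}
    (hs : MeasurableSet s) {ε : ℝ} (hε : 0 < ε) :
    ∃ K ∈ readableSets T α, MeasurableSet K ∧ μ.real (symmDiff K s) < ε := by
  obtain ⟨K, hK, hlt⟩ := exists_measure_symmDiff_lt_of_generateFrom_isSetRing (μ := μ)
    isSetRing_readableSets ⟨{univ}, countable_singleton _, by simpa using univ_mem_readableSets,
      by simp⟩ hgen hs (ε := ENNReal.ofReal ε) (ENNReal.ofReal_pos.2 hε)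
  refine ⟨K, hK, hK.1, ?_⟩
  rw [Measure.real]
  exact (ENNReal.lt_ofReal_iff_toReal_lt (measure_ne_top _ _)).1 hlt

/-- One half of the Kolmogorov–Sinai theorem on generators. -/
theorem partitionEntropy_le_of_generating {μ : Measure Ω} [IsProbabilityMeasure μ]
    (hgen : mΩ = MeasurableSpace.generateFrom (readableSets T α)) (hα : Measurable α)
    (hT : MeasurePreserving T μ μ) {k : ℕ} {ξ : Ω → Fin k} (hξ : Measurable ξ) {n : ℕ}
    (hn : n ≠ 0) :
    partitionEntropy T μ ξ ≤ ((labelEntropy μ (itinerary T α n) / n : ℝ) : EReal) := by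
  classical
  set u := fun n => labelEntropy μ (itinerary T α n) with hu
  have hsub : Subadditive u := subadditive_labelEntropy_itinerary hT hα
  suffices H : ∀ ε : ℝ, 0 < ε → partitionEntropy T μ ξ ≤ ((u n / n + ε : ℝ) : EReal) by
    refine EReal.le_of_forall_lt_iff_le.1 fun z hz => ?_
    have hz' : u n / n < z := by exact_mod_cast hz
    simpa using H (z - u n / n) (by linarith)
  intro ε hε
  obtain ⟨δ, hδ, hsmall⟩ := exists_labelEntropy_le_of_measureReal_ge (Fin k → Bool)
    (fun _ => false) (half_pos (half_pos hε))
  have hk : (0 : ℝ) < k + 1 := by positivity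
  choose K hKr hKm hKlt using fun c : Fin k => exists_readable_symmDiff_lt (μ := μ) hgen
    (hξ (measurableSet_singleton c)) (div_pos hδ hk)
  obtain ⟨N, m, hread⟩ := exists_forall_readable hKr
  -- `η` records membership in the readable approximations of the atoms of `ξ`, and `d` records the
  -- mismatches. Together they determine `ξ`; `d` has small entropy, and `η` costs no more than
  -- labels of `α` once the delay is removed by invariance.
  let η : Ω → Fin k → Bool := fun x c => decide (x ∈ K c)
  let d : Ω → Fin k → Bool := fun x c => decide (x ∈ symmDiff (K c) (ξ ⁻¹' {c}))
  have hη : Measurable η := measurable_pi_lambda _ fun c => by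
    refine measurable_to_bool ?_
    simpa [η, preimage] using hKm c
  have hd : Measurable d := measurable_pi_lambda _ fun c => by
    refine measurable_to_bool ?_
    simpa [d, preimage] using (hKm c).symmDiff (hξ (measurableSet_singleton c))
  have hdsmall : labelEntropy μ d ≤ ε / 2 / 2 := by
    refine hsmall Ω μ d hd ?_
    have : {x | d x ≠ fun _ => false} ⊆ ⋃ c ∈ Finset.univ, symmDiff (K c) (ξ ⁻¹' {c}) := by
      intro x hx
      obtain ⟨c, hc⟩ := Function.ne_iff.1 hx
      simp only [Finset.mem_univ, iUnion_true, mem_iUnion]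
      exact ⟨c, by simpa [d] using hc⟩
    calc _ ≤ μ.real (⋃ c ∈ Finset.univ, symmDiff (K c) (ξ ⁻¹' {c})) :=
          measureReal_mono this (measure_ne_top _ _)
      _ ≤ ∑ c, μ.real (symmDiff (K c) (ξ ⁻¹' {c})) := measureReal_biUnion_finset_le _ _
      _ ≤ ∑ _c : Fin k, δ / (k + 1) := Finset.sum_le_sum fun c _ => (hKlt c).le
      _ = k / (k + 1) * δ := by simp; ring
      _ ≤ 1 * δ := by
          gcongr
          rw [div_le_one hk]; linarith
      _ = δ := one_mul δ
  have hbound : ∀ l : ℕ, joinEntropy T μ ξ l ≤ u l + u m + l * (ε / 2 / 2) := by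
    intro l
    have hηl := measurable_itinerary hT.measurable hη l
    have hdl := measurable_itinerary hT.measurable hd l
    rw [joinEntropy_eq_labelEntropy]
    have h1 : labelEntropy μ (itinerary T ξ l) ≤
        labelEntropy μ (fun x => (itinerary T η l x, itinerary T d l x)) := by
      refine labelEntropy_le_of_factors (hηl.prodMk hdl) fun x y hxy => ?_
      rw [Prod.mk.injEq, itinerary_eq_iff, itinerary_eq_iff] at hxy
      refine itinerary_eq_iff.2 fun i hi => ?_
      have e1 := congrFun (hxy.1 i hi) (ξ (T^[i] y))
      have e2 := congrFun (hxy.2 i hi) (ξ (T^[i] y))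
      simp only [η, d, decide_eq_decide, mem_symmDiff, mem_preimage, mem_singleton_iff] at e1 e2
      tauto
    have h2 : labelEntropy μ (itinerary T η l) ≤ u (l + m) := by
      rw [← labelEntropy_comp_iterate hT hηl N]
      refine labelEntropy_le_of_factors (measurable_itinerary hT.measurable hα _) fun x y hxy => ?_
      refine itinerary_eq_iff.2 fun i hi => funext fun c => ?_
      simp only [η, decide_eq_decide]
      rw [← Function.iterate_add_apply, ← Function.iterate_add_apply, add_comm,
        Function.iterate_add_apply, Function.iterate_add_apply]
      refine hread c _ _ (itinerary_eq_iff.2 fun j hj => ?_)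
      rw [← Function.iterate_add_apply, ← Function.iterate_add_apply]
      exact itinerary_eq_iff.1 hxy (j + i) (by omega)
    calc _ ≤ _ := h1
      _ ≤ labelEntropy μ (itinerary T η l) + labelEntropy μ (itinerary T d l) :=
          labelEntropy_prodMk_le hηl hdl
      _ ≤ u (l + m) + l * labelEntropy μ d := add_le_add h2 (labelEntropy_itinerary_le hT hd l)
      _ ≤ _ := by gcongr; exact hsub l m
  -- The budget `ε` splits as `ε/2` for `u l / l` against `u n / n`, `ε/4` for the `m` extra labels,
  -- and `ε/4` for the mismatches.
  have hev1 := hsub.eventually_div_lt_of_div_lt hn (show u n / n < u n / n + ε / 2 by linarith)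
  have hev2 : ∀ᶠ l : ℕ in atTop, u m / l < ε / 2 / 2 :=
    (tendsto_const_div_atTop_nhds_zero_nat (u m)).eventually_lt_const (by positivity)
  refine limsup_le_of_le (by isBoundedDefault) ?_
  filter_upwards [hev1, hev2, eventually_gt_atTop 0] with l h1 h2 hl
  have hl' : (0 : ℝ) < l := by exact_mod_cast hl
  refine EReal.coe_le_coe_iff.2 ?_
  calc joinEntropy T μ ξ l / l ≤ (u l + u m + l * (ε / 2 / 2)) / l := by gcongr; exact hbound l
    _ = u l / l + u m / l + ε / 2 / 2 := by field_simp
    _ ≤ _ := by linarith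

theorem measureEntropy_le_of_generating {μ : Measure Ω} [IsProbabilityMeasure μ]
    (hgen : mΩ = MeasurableSpace.generateFrom (readableSets T α)) (hα : Measurable α)
    (hT : MeasurePreserving T μ μ) {n : ℕ} (hn : n ≠ 0) :
    measureEntropy T μ ≤ ((labelEntropy μ (itinerary T α n) / n : ℝ) : EReal) :=
  iSup_le fun _ => iSup_le fun _ => iSup_le fun hξ =>
    partitionEntropy_le_of_generating hgen hα hT hξ hn

end Generator

/-! ### Coded systems: combinatorics and counting -/

section Coding

/-- The sliding block code with window `r + 1` given by `F`, applied to the word `v`. -/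
def blockCode {A B : Type*} (F : List A → B) (r : ℕ) (v : List A) (n : ℕ) : Fin n → B :=
  fun j => F ((v.drop j).take (r + 1))

theorem List.take_drop_append_append {A : Type*} (p v q : List A) {j l : ℕ}
    (h : j + l ≤ v.length) : ((p ++ v ++ q).drop (p.length + j)).take l = (v.drop j).take l := by
  rw [List.append_assoc, List.drop_append, List.drop_of_length_le (by omega), List.nil_append,
    Nat.add_sub_cancel_left, List.drop_append_of_le_length (by omega),
    List.take_append_of_le_length (by simp; omega)]

/-- A system `T` with labelling `α` whose words are images, under a sliding block code, of words
over `A` of the form `0^i v (s k)`, where `v` ranges over a set `G` of words that can be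
concatenated freely and repeated periodically. -/
structure CodedSystem (A : Type*) {Ω B : Type*} (T : Ω → Ω) (α : Ω → B) where
  r : ℕ
  zero : A
  F : List A → B
  G : Set (List A)
  s : ℕ → List A
  nil_mem : [] ∈ G
  append_mem : ∀ {u v}, u ∈ G → v ∈ G → u ++ v ∈ G
  length_s : ∀ k, (s k).length = k
  exists_left : ∀ i, ∃ p, p ++ List.replicate i zero ∈ G
  exists_right : ∀ k, ∃ q, s k ++ q ∈ G
  cover : ∀ x n, ∃ i v k, v ∈ G ∧ i + v.length + k = n + r ∧
    itinerary T α n x = blockCode F r (List.replicate i zero ++ v ++ s k) n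
  realize : ∀ v ∈ G, v ≠ [] → ∃ x, T^[v.length] x = x ∧
    ∀ j, j + r < v.length → α (T^[j] x) = F ((v.drop j).take (r + 1))
  eq_of_periodic : ∀ x y k, 1 ≤ k → T^[k] x = x → T^[k] y = y →
    itinerary T α k x = itinerary T α k y → x = y

/-- The number of words of length `n`. -/
noncomputable def wordCount {Ω B : Type*} (T : Ω → Ω) (α : Ω → B) (n : ℕ) : ℕ :=
  (range (itinerary T α n)).ncard

/-- `h` is the exponential growth rate of the number of words. -/
structure IsGrowthRate {Ω B : Type*} (T : Ω → Ω) (α : Ω → B) (h : ℝ) : Prop where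
  nonneg : 0 ≤ h
  exp_le : ∀ n : ℕ, Real.exp (n * h) ≤ wordCount T α n
  tendsto : Tendsto (fun n : ℕ => Real.log (wordCount T α n) / n) atTop (𝓝 h)

/-! ### Submultiplicativity and the growth rate of words. -/

section WordCount

variable {Ω : Type*} {p : ℕ} {T : Ω → Ω} {α : Ω → Fin p}

theorem wordCount_pos [Nonempty Ω] (n : ℕ) : 0 < wordCount T α n :=
  (ncard_pos (toFinite _)).2 (range_nonempty _)

theorem wordCount_add_le (m n : ℕ) :
    wordCount T α (m + n) ≤ wordCount T α m * wordCount T α n := by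
  unfold wordCount
  rw [← ncard_prod]
  refine (ncard_le_ncard (t := (fun w : (Fin m → Fin p) × (Fin n → Fin p) =>
    Fin.append w.1 w.2) '' _) ?_ (toFinite _)).trans (ncard_image_le (toFinite _))
  rintro _ ⟨x, rfl⟩
  refine ⟨(itinerary T α m x, itinerary T α n (T^[m] x)), ⟨⟨x, rfl⟩, ⟨_, rfl⟩⟩, ?_⟩
  funext i
  refine Fin.addCases (fun i => ?_) (fun i => ?_) i
  · simp [itinerary]
  · simp [itinerary, ← Function.iterate_add_apply, add_comm]

theorem wordCount_mono {m n : ℕ} (hmn : m ≤ n) : wordCount T α m ≤ wordCount T α n := by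
  unfold wordCount
  refine (ncard_le_ncard (t := (fun w : Fin n → Fin p => w ∘ Fin.castLE hmn) '' _) ?_
    (toFinite _)).trans (ncard_image_le (toFinite _))
  rintro _ ⟨x, rfl⟩
  exact ⟨_, ⟨x, rfl⟩, rfl⟩

/-- Fekete's lemma: the limit is also an infimum, hence the lower bound `exp_le` at every length. -/
theorem exists_isGrowthRate [Nonempty Ω] : ∃ h, IsGrowthRate T α h := by
  have hpos : ∀ n, (1 : ℝ) ≤ wordCount T α n := fun n => by exact_mod_cast wordCount_pos n
  have hsub : Subadditive fun n => Real.log (wordCount T α n) := by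
    intro m n
    rw [← Real.log_mul (by linarith [hpos m]) (by linarith [hpos n])]
    exact Real.log_le_log (by linarith [hpos (m + n)]) (by exact_mod_cast wordCount_add_le m n)
  have hnn : ∀ n : ℕ, 0 ≤ Real.log (wordCount T α n) / n := fun n =>
    div_nonneg (Real.log_nonneg (hpos n)) (Nat.cast_nonneg n)
  have hbdd : BddBelow (range fun n : ℕ => Real.log (wordCount T α n) / n) :=
    ⟨0, by rintro _ ⟨n, rfl⟩; exact hnn n⟩
  have ht := hsub.tendsto_lim hbdd
  refine ⟨hsub.lim, ge_of_tendsto' ht hnn, fun n => ?_, ht⟩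
  rcases Nat.eq_zero_or_pos n with rfl | hn
  · simpa using hpos 0
  have hn' : (0 : ℝ) < n := by exact_mod_cast hn
  have := hsub.lim_le_div hbdd hn.ne'
  rw [le_div_iff₀ hn'] at this
  rw [← Real.le_log_iff_exp_le (by linarith [hpos n])]
  linarith

end WordCount

/-! ### Counting the words of a coded system. -/

namespace CodedSystem

variable {A Ω : Type*} {p : ℕ} {T : Ω → Ω} {α : Ω → Fin p} (c : CodedSystem A T α) {h : ℝ}

/-- The images under the block code of the words in `G` of length `m`. -/
def codeWords (m : ℕ) : Set (Fin (m - c.r) → Fin p) :=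
  (fun v => blockCode c.F c.r v (m - c.r)) '' {v | v ∈ c.G ∧ v.length = m}

/-- The number of images under the block code of the words in `G` of length `m`. -/
noncomputable def codeCount (m : ℕ) : ℕ := (c.codeWords m).ncard

theorem replicate_append_mem {v : List A} (hv : v ∈ c.G) (n : ℕ) :
    (List.replicate n v).flatten ∈ c.G := by
  induction n with
  | zero => simpa using c.nil_mem
  | succ n ih => simpa [List.replicate_succ] using c.append_mem hv ih

theorem exists_mem_ne_nil : ∃ v ∈ c.G, v ≠ [] := by
  obtain ⟨p, hp⟩ := c.exists_left 1
  exact ⟨_, hp, by simp⟩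

theorem nonempty (c : CodedSystem A T α) : Nonempty Ω := by
  obtain ⟨v, hv, hne⟩ := c.exists_mem_ne_nil
  exact ⟨(c.realize v hv hne).choose⟩

theorem codeCount_zero : c.codeCount 0 = 1 := by
  have : IsEmpty (Fin (0 - c.r)) := by rw [Nat.zero_sub]; infer_instance
  have : c.codeWords 0 = univ :=
    eq_univ_of_forall fun w => ⟨[], ⟨c.nil_mem, rfl⟩, Subsingleton.elim _ _⟩
  rw [codeCount, this, ncard_univ, Nat.card_unique]

/-- The images of `u` and of `v` are both subwords of the image of `u ++ v`; only the windows
crossing the seam are dropped. Counting by the length in `A` rather than by the length of the image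
avoids any loss in the inequality. -/
theorem codeCount_mul_le (m n : ℕ) : c.codeCount m * c.codeCount n ≤ c.codeCount (m + n) := by
  unfold codeCount
  rw [← ncard_prod]
  refine (ncard_le_ncard (t := (fun w : Fin (m + n - c.r) → Fin p =>
    ((fun j => w ⟨j, by omega⟩ : Fin (m - c.r) → Fin p),
      (fun j => w ⟨m + j, by omega⟩ : Fin (n - c.r) → Fin p))) '' c.codeWords (m + n)) ?_
    (toFinite _)).trans (ncard_image_le (toFinite _))
  rintro ⟨_, _⟩ ⟨⟨u, ⟨hu, hum⟩, rfl⟩, ⟨v, ⟨hv, hvn⟩, rfl⟩⟩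
  refine ⟨_, ⟨u ++ v, ⟨c.append_mem hu hv, by simp [hum, hvn]⟩, rfl⟩, ?_⟩
  refine Prod.ext (funext fun j => ?_) (funext fun j => ?_)
  · have := List.take_drop_append_append [] u v (j := j) (l := c.r + 1) (by omega)
    simp only [List.nil_append, List.length_nil, zero_add] at this
    simp only [blockCode, this]
  · have := List.take_drop_append_append u v [] (j := j) (l := c.r + 1) (by omega)
    rw [List.append_nil, hum] at this
    simp only [blockCode, this]

theorem codeCount_pow_le (m k : ℕ) : c.codeCount m ^ k ≤ c.codeCount (k * m) := by
  induction k with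
  | zero => simp [codeCount_zero]
  | succ k ih =>
    calc c.codeCount m ^ (k + 1) = c.codeCount m ^ k * c.codeCount m := pow_succ _ _
      _ ≤ c.codeCount (k * m) * c.codeCount m := Nat.mul_le_mul_right _ ih
      _ ≤ _ := by rw [add_mul, one_mul]; exact c.codeCount_mul_le _ _

theorem codeCount_le_wordCount (m : ℕ) : c.codeCount m ≤ wordCount T α m := by
  refine (ncard_le_ncard ?_ (toFinite _)).trans (wordCount_mono (Nat.sub_le m c.r))
  rintro _ ⟨v, ⟨hv, hvm⟩, rfl⟩
  by_cases hne : v = []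
  · subst hne
    obtain ⟨x⟩ := c.nonempty
    refine ⟨x, funext fun j => ?_⟩
    have := j.2
    simp only [List.length_nil] at hvm
    omega
  · obtain ⟨x, -, hx⟩ := c.realize v hv hne
    exact ⟨x, funext fun j => hx j (by omega)⟩

/-- By supermultiplicativity the `k`-th power of the count at `m` is at most the number of words of
length `k m`. Take `k`-th roots and let `k → ∞`. -/
theorem codeCount_le_exp (hh : IsGrowthRate T α h) (m : ℕ) :
    (c.codeCount m : ℝ) ≤ Real.exp (m * h) := by
  rcases Nat.eq_zero_or_pos m with rfl | hm
  · simp [codeCount_zero]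
  rcases Nat.eq_zero_or_pos (c.codeCount m) with h0 | hpos
  · rw [h0]; simpa using (Real.exp_pos _).le
  have hpos' : (0 : ℝ) < c.codeCount m := by exact_mod_cast hpos
  rw [← Real.log_le_iff_le_exp hpos']
  have hm' : (0 : ℝ) < m := by exact_mod_cast hm
  have ht : Tendsto (fun k : ℕ => Real.log (wordCount T α (k * m)) / ((k * m : ℕ) : ℝ)) atTop
      (𝓝 h) := hh.tendsto.comp (tendsto_id.atTop_mul_const' hm)
  rw [mul_comm, ← div_le_iff₀ hm']
  refine ge_of_tendsto ht ?_
  filter_upwards [eventually_gt_atTop 0] with k hk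
  have hk' : (0 : ℝ) < k := by exact_mod_cast hk
  have h1 : (c.codeCount m : ℝ) ^ k ≤ wordCount T α (k * m) := by
    exact_mod_cast (c.codeCount_pow_le m k).trans (c.codeCount_le_wordCount _)
  have h2 := Real.log_le_log (by positivity) h1
  rw [Real.log_pow] at h2
  rw [div_le_div_iff₀ hm' (by positivity)]
  push_cast
  nlinarith

/-- The words of length `n` coming from words over `A` of the form `0^i v (s k)`. -/
def decompWords (n i k : ℕ) : Set (Fin n → Fin p) :=
  {w | ∃ v ∈ c.G, i + v.length + k = n + c.r ∧
    w = blockCode c.F c.r (List.replicate i c.zero ++ v ++ c.s k) n}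

theorem exists_mem_decompWords (n : ℕ) (x : Ω) :
    ∃ i ≤ n + c.r, ∃ k ≤ n + c.r, itinerary T α n x ∈ c.decompWords n i k := by
  obtain ⟨i, v, k, hv, hl, hw⟩ := c.cover x n
  exact ⟨i, by omega, k, by omega, v, hv, hl, hw⟩

/-- Labels with window inside `0^i` or inside `s k` are forced, and those with window inside `v`
form a code word. At most `r` windows cross each of the two seams, and each seam contributes a
factor `p ^ r`. -/
theorem ncard_decompWords_le (n i k : ℕ) :
    (c.decompWords n i k).ncard ≤ c.codeCount (n + c.r - i - k) * (p ^ c.r * p ^ c.r) := by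
  rcases lt_or_ge (n + c.r) (i + k) with hlt | hle
  · have : c.decompWords n i k = ∅ := by
      refine eq_empty_of_forall_notMem ?_
      rintro w ⟨v, -, hl, -⟩
      omega
    simp [this]
  set m := n + c.r - i - k with hm
  have hcard : ((c.codeWords m) ×ˢ ((univ : Set (Fin c.r → Fin p)) ×ˢ
      (univ : Set (Fin c.r → Fin p)))).ncard = c.codeCount m * (p ^ c.r * p ^ c.r) := by
    simp [ncard_prod, ncard_univ, codeCount]
  rw [← hcard]
  -- `Φ` rebuilds the word from its code word and the two groups of seam labels. The five cases are:
  -- window in the zeros, across the left seam, inside `v`, starting in `v` but leaving it, and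
  -- inside `s k`.
  let Φ : (Fin (m - c.r) → Fin p) × ((Fin c.r → Fin p) × (Fin c.r → Fin p)) → (Fin n → Fin p) :=
    fun w j =>
      if h0 : (j : ℕ) + c.r < i then c.F (List.replicate (c.r + 1) c.zero)
      else if h1 : (j : ℕ) < i then w.2.1 ⟨j + c.r - i, by omega⟩
      else if h2 : (j : ℕ) - i < m - c.r then w.1 ⟨j - i, h2⟩
      else if h3 : (j : ℕ) < i + m then w.2.2 ⟨j - i - (m - c.r), by omega⟩
      else c.F (((c.s k).drop (j - i - m)).take (c.r + 1))
  refine (ncard_le_ncard (t := Φ '' _) ?_ (toFinite _)).trans (ncard_image_le (toFinite _))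
  rintro w ⟨v, hv, hl, rfl⟩
  have hvm : v.length = m := by omega
  set u := List.replicate i c.zero ++ v ++ c.s k with hu
  refine ⟨(blockCode c.F c.r v (m - c.r),
    (fun j => c.F ((u.drop (j + i - c.r)).take (c.r + 1))),
    (fun j => c.F ((u.drop (j + (m - c.r) + i)).take (c.r + 1)))),
    ⟨⟨v, ⟨hv, hvm⟩, rfl⟩, trivial, trivial⟩, ?_⟩
  funext j
  simp only [Φ, blockCode]
  split_ifs with h0 h1 h2 h3
  · have := List.take_drop_append_append [] (List.replicate i c.zero) (v ++ c.s k)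
      (j := j) (l := c.r + 1) (by simp; omega)
    simp only [List.nil_append, List.length_nil, zero_add, ← List.append_assoc] at this
    rw [hu, this]
    congr 1
    rw [List.drop_replicate, List.take_replicate]
    congr 1
    omega
  · congr 3
    omega
  · have := List.take_drop_append_append (List.replicate i c.zero) v (c.s k)
      (j := j - i) (l := c.r + 1) (by omega)
    rw [List.length_replicate, Nat.add_sub_cancel' (by omega)] at this
    rw [hu, this]
  · congr 3
    omega
  · have := List.take_drop_append_append (List.replicate i c.zero ++ v) (c.s k) []
      (j := j - i - m) (l := c.r + 1) (by rw [c.length_s]; omega)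
    rw [List.append_nil, List.length_append, List.length_replicate, hvm] at this
    rw [hu, ← this]
    congr 3
    omega

theorem sum_ncard_decompWords_le (hh : IsGrowthRate T α h) (n : ℕ) (S : Finset (ℕ × ℕ)) :
    (∑ a ∈ S, ((c.decompWords n a.1 a.2).ncard : ℝ)) ≤
      (p ^ c.r * p ^ c.r * Real.exp (c.r * h)) * Real.exp (n * h) *
        ∑ a ∈ S, Real.exp (-h) ^ a.1 * Real.exp (-h) ^ a.2 := by
  rw [Finset.mul_sum]
  refine Finset.sum_le_sum fun a _ => ?_
  rcases lt_or_ge (n + c.r) (a.1 + a.2) with hlt | hle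
  · have : c.decompWords n a.1 a.2 = ∅ := by
      refine eq_empty_of_forall_notMem ?_
      rintro w ⟨v, -, hl, -⟩
      omega
    rw [this, ncard_empty, Nat.cast_zero]
    positivity
  have hcast : ((n + c.r - a.1 - a.2 : ℕ) : ℝ) = n + c.r - a.1 - a.2 := by
    rw [Nat.sub_sub, Nat.cast_sub hle]; push_cast; ring
  calc ((c.decompWords n a.1 a.2).ncard : ℝ)
      ≤ c.codeCount (n + c.r - a.1 - a.2) * (p ^ c.r * p ^ c.r) := by
        exact_mod_cast c.ncard_decompWords_le n a.1 a.2
    _ ≤ Real.exp ((n + c.r - a.1 - a.2 : ℕ) * h) * (p ^ c.r * p ^ c.r) := by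
        gcongr
        exact c.codeCount_le_exp hh _
    _ = _ := by
        rw [hcast, ← Real.exp_nat_mul, ← Real.exp_nat_mul]
        have : ((n : ℝ) + c.r - a.1 - a.2) * h =
          c.r * h + n * h + (a.1 * -h + a.2 * -h) := by ring
        rw [this, Real.exp_add, Real.exp_add, Real.exp_add]
        ring

theorem summable_exp_pow_mul (hpos : 0 < h) :
    Summable fun a : ℕ × ℕ => Real.exp (-h) ^ a.1 * Real.exp (-h) ^ a.2 := by
  have hs : Summable fun n : ℕ => Real.exp (-h) ^ n :=
    summable_geometric_of_lt_one (Real.exp_pos _).le (Real.exp_lt_one_iff.2 (by linarith))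
  exact hs.mul_of_nonneg hs (fun _ => by positivity) fun _ => by positivity

/-- Prefix length `i` and suffix length `k` leave at most a constant times `exp ((n - i - k) h)`
words, and `∑ exp (-i h) exp (-k h)` converges because `h > 0`. -/
theorem exists_wordCount_le (c : CodedSystem A T α) (hh : IsGrowthRate T α h) (hpos : 0 < h) :
    ∃ C : ℝ, 1 ≤ C ∧ ∀ n : ℕ, (wordCount T α n : ℝ) ≤ C * Real.exp (n * h) := by
  classical
  set K : ℝ := p ^ c.r * p ^ c.r * Real.exp (c.r * h) with hK
  have hK0 : 0 ≤ K := by positivity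
  -- The lower bound `1` ensures `0 ≤ log C` in later entropy estimates.
  refine ⟨max 1 (K * ∑' a : ℕ × ℕ, Real.exp (-h) ^ a.1 * Real.exp (-h) ^ a.2),
    le_max_left _ _, fun n => ?_⟩
  let S : Finset (ℕ × ℕ) := Finset.range (n + c.r + 1) ×ˢ Finset.range (n + c.r + 1)
  have hcov : range (itinerary T α n) ⊆ ⋃ a ∈ S, c.decompWords n a.1 a.2 := by
    rintro _ ⟨x, rfl⟩
    obtain ⟨i, hi, k, hk, hx⟩ := c.exists_mem_decompWords n x
    simp only [mem_iUnion]
    exact ⟨(i, k), by simp [S]; omega, hx⟩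
  calc (wordCount T α n : ℝ) ≤ ∑ a ∈ S, ((c.decompWords n a.1 a.2).ncard : ℝ) := by
        exact_mod_cast (ncard_le_ncard hcov (toFinite _)).trans
          (Finset.set_ncard_biUnion_le S _)
    _ ≤ K * Real.exp (n * h) * ∑ a ∈ S, Real.exp (-h) ^ a.1 * Real.exp (-h) ^ a.2 :=
        c.sum_ncard_decompWords_le hh n S
    _ ≤ K * Real.exp (n * h) * ∑' a : ℕ × ℕ, Real.exp (-h) ^ a.1 * Real.exp (-h) ^ a.2 := by
        gcongr
        exact (summable_exp_pow_mul hpos).sum_le_tsum _ fun _ _ => by positivity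
    _ = (K * ∑' a : ℕ × ℕ, Real.exp (-h) ^ a.1 * Real.exp (-h) ^ a.2) * Real.exp (n * h) := by
        ring
    _ ≤ _ := by
        gcongr
        exact le_max_right _ _

/-- A set of words whose size is a positive fraction of `exp (n h)` contains a subset of
comparable size consisting of words that occur, all at the same place, in images of words of `G`
of the same length. -/
theorem exists_good_subset (hh : IsGrowthRate T α h) (hpos : 0 < h) {δ : ℝ} (hδ : 0 < δ) :
    ∃ κ > 0, ∃ τ : ℕ, ∀ (n : ℕ) (D : Set (Fin n → Fin p)), D ⊆ range (itinerary T α n) →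
      δ * Real.exp (n * h) ≤ D.ncard → ∃ a m : ℕ, a + n + c.r ≤ m ∧ m ≤ n + τ ∧
        ∃ D' ⊆ D, κ * Real.exp (n * h) ≤ D'.ncard ∧
          ∀ w ∈ D', ∃ V ∈ c.G, V.length = m ∧
            ∀ j : Fin n, w j = c.F ((V.drop (a + j)).take (c.r + 1)) := by
  classical
  set K : ℝ := p ^ c.r * p ^ c.r * Real.exp (c.r * h) with hK
  have hK0 : 0 ≤ K := by positivity
  choose pl hpl using c.exists_left
  choose ql hql using c.exists_right
  -- Outside the finite set `S` of pairs (prefix length, suffix length) the tail is so small that at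
  -- most half of `D` is lost. By pigeonhole one pair in `S` carries a share `1 / N` of the rest.
  -- The `+ 1` in `K + 1` and in `N` avoids division by zero.
  obtain ⟨S, hS⟩ := summable_iff_vanishing_norm.1 (summable_exp_pow_mul hpos)
    (δ / 2 / (K + 1)) (by positivity)
  set N : ℝ := S.card + 1 with hN
  have hN0 : 0 < N := by positivity
  refine ⟨δ / 2 / N, by positivity,
    ∑ a ∈ S, ((pl a.1).length + (ql a.2).length + c.r), fun n D hD hcard => ?_⟩
  have hcov : D ⊆ (⋃ a ∈ (Finset.range (n + c.r + 1) ×ˢ Finset.range (n + c.r + 1)) \ S,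
      c.decompWords n a.1 a.2) ∪ ⋃ a ∈ S, (D ∩ c.decompWords n a.1 a.2) := by
    intro w hw
    obtain ⟨x, rfl⟩ := hD hw
    obtain ⟨i, hi, k, hk, hx⟩ := c.exists_mem_decompWords n x
    by_cases hiS : (i, k) ∈ S
    · refine Or.inr ?_
      simp only [mem_iUnion]
      exact ⟨(i, k), hiS, hw, hx⟩
    · refine Or.inl ?_
      simp only [mem_iUnion]
      refine ⟨(i, k), ?_, hx⟩
      simp only [Finset.mem_sdiff, Finset.mem_product, Finset.mem_range]
      exact ⟨by omega, hiS⟩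
  have hbad : (∑ a ∈ (Finset.range (n + c.r + 1) ×ˢ Finset.range (n + c.r + 1)) \ S,
      ((c.decompWords n a.1 a.2).ncard : ℝ)) ≤ δ / 2 * Real.exp (n * h) := by
    refine (c.sum_ncard_decompWords_le hh n _).trans ?_
    have h1 := hS ((Finset.range (n + c.r + 1) ×ˢ Finset.range (n + c.r + 1)) \ S)
      Finset.sdiff_disjoint
    rw [Real.norm_eq_abs] at h1
    have h2 := (le_abs_self _).trans h1.le
    calc _ ≤ K * Real.exp (n * h) * (δ / 2 / (K + 1)) := by gcongr
      _ = (K / (K + 1)) * (δ / 2 * Real.exp (n * h)) := by ring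
      _ ≤ 1 * (δ / 2 * Real.exp (n * h)) := by
          gcongr
          rw [div_le_one (by positivity)]; linarith
      _ = _ := one_mul _
  have hgood : δ / 2 * Real.exp (n * h) ≤
      ∑ a ∈ S, ((D ∩ c.decompWords n a.1 a.2).ncard : ℝ) := by
    have h1 : (D.ncard : ℝ) ≤
        (∑ a ∈ (Finset.range (n + c.r + 1) ×ˢ Finset.range (n + c.r + 1)) \ S,
          ((c.decompWords n a.1 a.2).ncard : ℝ)) +
        ∑ a ∈ S, ((D ∩ c.decompWords n a.1 a.2).ncard : ℝ) := by
      exact_mod_cast (ncard_le_ncard hcov (toFinite _)).trans ((ncard_union_le _ _).trans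
        (add_le_add (Finset.set_ncard_biUnion_le _ _) (Finset.set_ncard_biUnion_le _ _)))
    linarith
  obtain ⟨a, haS, ha⟩ : ∃ a ∈ S, δ / 2 / N * Real.exp (n * h) ≤
      (D ∩ c.decompWords n a.1 a.2).ncard := by
    by_contra! hcon
    have h1 : ∑ a ∈ S, ((D ∩ c.decompWords n a.1 a.2).ncard : ℝ) ≤
        S.card * (δ / 2 / N * Real.exp (n * h)) := by
      rw [← nsmul_eq_mul]
      exact Finset.sum_le_card_nsmul _ _ _ fun a ha => (hcon a ha).le
    have h2 : (S.card : ℝ) * (δ / 2 / N * Real.exp (n * h)) <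
        N * (δ / 2 / N * Real.exp (n * h)) := by
      gcongr
      linarith
    have h3 : N * (δ / 2 / N * Real.exp (n * h)) = δ / 2 * Real.exp (n * h) := by field_simp
    linarith
  have hτ : (pl a.1).length + (ql a.2).length + c.r ≤
      ∑ a ∈ S, ((pl a.1).length + (ql a.2).length + c.r) :=
    Finset.single_le_sum (f := fun a : ℕ × ℕ => (pl a.1).length + (ql a.2).length + c.r)
      (fun _ _ => Nat.zero_le _) haS
  -- All chosen words share the same pair, so the same completions on the left and right give a
  -- common length and position. `τ` bounds these completions over all of `S`.
  refine ⟨(pl a.1).length, (pl a.1).length + (n + c.r) + (ql a.2).length, by omega, by omega,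
    D ∩ c.decompWords n a.1 a.2, inter_subset_left, ha, ?_⟩
  rintro w ⟨-, v, hv, hl, rfl⟩
  refine ⟨pl a.1 ++ (List.replicate a.1 c.zero ++ v ++ c.s a.2) ++ ql a.2, ?_, ?_, fun j => ?_⟩
  · have := c.append_mem (c.append_mem (hpl a.1) hv) (hql a.2)
    simpa only [List.append_assoc] using this
  · simp only [List.length_append, List.length_replicate, c.length_s]
    omega
  · rw [List.take_drop_append_append]
    · rfl
    · simp only [List.length_append, List.length_replicate, c.length_s]
      omega

/-- The length `j ≤ N` cannot be prescribed, since `G` may have no word of length `N`. For the same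
reason, periodic points are counted by period at most `N`. -/
theorem exists_codeCount_ge (hh : IsGrowthRate T α h) (hpos : 0 < h) :
    ∃ κ > 0, ∀ N : ℕ, ∃ j ≤ N, κ * Real.exp (N * h) ≤ c.codeCount j := by
  obtain ⟨κ, hκ, τ, H⟩ := c.exists_good_subset hh hpos one_pos
  -- For `N < τ` the empty word (`j = 0`) suffices, thanks to the minimum with `1`. Otherwise all
  -- words of length `N - τ` are extended, by at most `τ` letters together with the window.
  refine ⟨min κ 1 * Real.exp (-(τ * h)), by positivity, fun N => ?_⟩
  rcases lt_or_ge N τ with hlt | hle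
  · refine ⟨0, Nat.zero_le _, ?_⟩
    have hN : (N : ℝ) ≤ τ := by exact_mod_cast hlt.le
    rw [codeCount_zero, mul_assoc, ← Real.exp_add, Nat.cast_one]
    refine mul_le_one₀ (min_le_right _ _) (Real.exp_pos _).le (Real.exp_le_one_iff.2 ?_)
    nlinarith
  · obtain ⟨a, m, ham, hm, D', -, hcard, hD'⟩ := H (N - τ) (range (itinerary T α (N - τ)))
      subset_rfl (by simpa using! hh.exp_le (N - τ))
    refine ⟨m, by omega, ?_⟩
    have hle' : D'.ncard ≤ c.codeCount m := by
      refine (ncard_le_ncard (t := (fun (w : Fin (m - c.r) → Fin p) (j : Fin (N - τ)) =>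
        w ⟨a + j, by omega⟩) '' c.codeWords m) ?_ (toFinite _)).trans
          (ncard_image_le (toFinite _))
      intro w hw
      obtain ⟨V, hV, hVm, hwV⟩ := hD' w hw
      exact ⟨_, ⟨V, ⟨hV, hVm⟩, rfl⟩, funext fun j => (hwV j).symm⟩
    have e : ((N - τ : ℕ) : ℝ) * h = -(τ * h) + N * h := by rw [Nat.cast_sub hle]; ring
    rw [e, Real.exp_add, ← mul_assoc] at hcard
    calc _ ≤ κ * Real.exp (-(τ * h)) * Real.exp (N * h) := by
          gcongr
          exact min_le_left _ _
      _ ≤ _ := hcard.trans (by exact_mod_cast hle')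

/-- If words do not grow exponentially then the labelling is constant. -/
theorem label_eq_of_growthRate_zero (hh : IsGrowthRate T α 0) (x : Ω) :
    α x = c.F (List.replicate (c.r + 1) c.zero) := by
  set z := c.F (List.replicate (c.r + 1) c.zero) with hz
  -- For `h = 0` there is at most one code word of each length.
  have hone : ∀ U ∈ c.G, ∀ U' ∈ c.G, U.length = U'.length → ∀ j, j + c.r < U.length →
      c.F ((U.drop j).take (c.r + 1)) = c.F ((U'.drop j).take (c.r + 1)) := by
    intro U hU U' hU' hl j hj
    have hle : c.codeCount U.length ≤ 1 := by
      have := c.codeCount_le_exp hh U.length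
      rw [mul_zero, Real.exp_zero] at this
      exact_mod_cast this
    have := (ncard_le_one (toFinite _)).1 hle _ ⟨U, ⟨hU, rfl⟩, rfl⟩ _ ⟨U', ⟨hU', hl.symm⟩, rfl⟩
    exact congrFun this ⟨j, by omega⟩
  -- `U ++ U'` and `U' ++ U` have equal length, so words of different lengths agree as far as both
  -- reach.
  have hany : ∀ U ∈ c.G, ∀ U' ∈ c.G, ∀ j, j + c.r < U.length → j + c.r < U'.length →
      c.F ((U.drop j).take (c.r + 1)) = c.F ((U'.drop j).take (c.r + 1)) := by
    intro U hU U' hU' j hj hj'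
    have h1 := hone _ (c.append_mem hU hU') _ (c.append_mem hU' hU)
      (by simp [add_comm]) j (by simp; omega)
    have e1 := List.take_drop_append_append [] U U' (j := j) (l := c.r + 1) (by omega)
    have e2 := List.take_drop_append_append [] U' U (j := j) (l := c.r + 1) (by omega)
    simp only [List.nil_append, List.length_nil, zero_add] at e1 e2
    rwa [e1, e2] at h1
  obtain ⟨V₀, hV₀, hne⟩ := c.exists_mem_ne_nil
  have hq : 0 < V₀.length := List.length_pos_iff.2 hne
  -- Prepending copies of `V₀` shows that all code words are beginnings of one sequence of period
  -- `V₀.length`. A run of zeros covering a whole period then makes that sequence constant.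
  have hshift : ∀ U ∈ c.G, ∀ U' ∈ c.G, ∀ t j, t * V₀.length + j + c.r < U.length →
      j + c.r < U'.length →
      c.F ((U.drop (t * V₀.length + j)).take (c.r + 1)) =
        c.F ((U'.drop j).take (c.r + 1)) := by
    intro U hU U' hU' t j hj hj'
    have hmem := c.replicate_append_mem hV₀ t
    have hlen : ((List.replicate t V₀).flatten).length = t * V₀.length := by simp
    rw [hany U hU _ (c.append_mem hmem hU') _ hj (by rw [List.length_append, hlen]; omega)]
    have e := List.take_drop_append_append ((List.replicate t V₀).flatten) U' [] (j := j)
      (l := c.r + 1) (by omega)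
    rw [List.append_nil, hlen] at e
    rw [e]
  obtain ⟨P, hP⟩ := c.exists_left (V₀.length + c.r)
  have hconst : ∀ U ∈ c.G, ∀ j, j + c.r < U.length →
      c.F ((U.drop j).take (c.r + 1)) = z := by
    intro U hU j hj
    -- a position in the run of zeros of `P 0^i` that is congruent to `j`
    obtain ⟨b, t, t', hb, hbt⟩ : ∃ b t t' : ℕ, b < V₀.length ∧
        t * V₀.length + j = t' * V₀.length + (P.length + b) := by
      -- With `q = V₀.length` and `t = P.length`, `t q + j = P.length + (j + P.length (q - 1))`.
      -- Division of the last bracket by `q` gives `t'` and `b` without subtracting `P.length` from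
      -- `j`.
      refine ⟨(j + P.length * (V₀.length - 1)) % V₀.length, P.length,
        (j + P.length * (V₀.length - 1)) / V₀.length, Nat.mod_lt _ hq, ?_⟩
      have h1 := Nat.div_add_mod (j + P.length * (V₀.length - 1)) V₀.length
      have h2 : P.length * V₀.length = P.length * (V₀.length - 1) + P.length := by
        conv_lhs => rw [show V₀.length = V₀.length - 1 + 1 by omega]
        ring
      rw [mul_comm V₀.length] at h1
      omega
    have hbig : (t * V₀.length + j + c.r) <
        ((List.replicate (t * V₀.length + j + c.r + 1) V₀).flatten).length := by
      simp only [List.length_flatten, List.map_replicate, List.sum_replicate, smul_eq_mul]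
      exact (Nat.lt_succ_self _).trans_le (Nat.le_mul_of_pos_right _ hq)
    have hW := c.replicate_append_mem hV₀ (t * V₀.length + j + c.r + 1)
    have e1 := hshift _ hW U hU t j hbig hj
    have e2 := hshift _ hW _ hP t' (P.length + b) (by rw [← hbt]; exact hbig) (by simp; omega)
    rw [← hbt] at e2
    rw [← e1, e2]
    have e3 := List.take_drop_append_append P (List.replicate (V₀.length + c.r) c.zero) []
      (j := b) (l := c.r + 1) (by simp; omega)
    rw [List.append_nil] at e3
    rw [e3, hz, List.drop_replicate, List.take_replicate]
    congr 2
    omega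
  obtain ⟨i, v, k, hv, hl, hx⟩ := c.cover x 1
  have hx0 := congrFun hx 0
  obtain ⟨p', hp'⟩ := c.exists_left i
  obtain ⟨q', hq'⟩ := c.exists_right k
  have hmem : p' ++ (List.replicate i c.zero ++ v ++ c.s k) ++ q' ∈ c.G := by
    have := c.append_mem (c.append_mem hp' hv) hq'
    simpa only [List.append_assoc] using this
  have e := List.take_drop_append_append p' (List.replicate i c.zero ++ v ++ c.s k) q' (j := 0)
    (l := c.r + 1) (by simp [c.length_s]; omega)
  have := hconst _ hmem (p'.length + 0) (by simp [c.length_s]; omega)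
  rw [e] at this
  rw [← this]
  exact hx0

end CodedSystem

end Coding

/-! ### Entropy bounds by counting -/

section EntropyBounds

variable {Ω ι : Type*} [MeasurableSpace Ω] [Fintype ι] [MeasurableSpace ι]
  [MeasurableSingletonClass ι] {μ : Measure Ω} {f : Ω → ι}

theorem measureReal_preimage_eq_sum {Ω ι : Type*} [MeasurableSpace Ω] [MeasurableSpace ι]
    [MeasurableSingletonClass ι] {μ : Measure Ω} {f : Ω → ι} [IsFiniteMeasure μ]
    (hf : Measurable f) (D : Finset ι) :
    μ.real (f ⁻¹' D) = ∑ i ∈ D, μ.real (f ⁻¹' {i}) := by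
  have : f ⁻¹' D = ⋃ i ∈ D, f ⁻¹' {i} := by ext x; simp
  rw [this]
  refine measureReal_biUnion_finset (fun i _ j _ hij => Set.disjoint_left.2 ?_)
    fun j _ => hf (measurableSet_singleton j)
  intro x hx hx'
  exact hij (by rw [← (show f x = i from hx), ← (show f x = j from hx')])

/-- Gibbs' inequality with weights `1 / (2 |D|)` on `D` and `1 / (2 |R|)` on the rest of `R`; the
factor `2` costs `log 2`. -/
theorem labelEntropy_le_of_subset [IsProbabilityMeasure μ] (hf : Measurable f) {D R : Set ι}
    (hDR : D ⊆ R) (hD : D.Nonempty) (hR : ∀ x, f x ∈ R) :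
    labelEntropy μ f ≤ Real.log 2 + μ.real (f ⁻¹' D) * Real.log D.ncard +
      (1 - μ.real (f ⁻¹' D)) * Real.log R.ncard := by
  classical
  obtain ⟨D, rfl⟩ := (toFinite D).exists_finset_coe
  obtain ⟨R, rfl⟩ := (toFinite R).exists_finset_coe
  rw [Finset.coe_subset] at hDR
  rw [Finset.coe_nonempty] at hD
  have hd : (0 : ℝ) < D.card := by exact_mod_cast hD.card_pos
  have hr : (0 : ℝ) < R.card := by exact_mod_cast (hD.mono hDR).card_pos
  rw [ncard_coe_finset, ncard_coe_finset]
  have hzero : ∀ i ∉ R, μ.real (f ⁻¹' {i}) = 0 := by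
    intro i hi
    have : f ⁻¹' {i} = ∅ := eq_empty_of_forall_notMem fun x (hx : f x = i) => hi (hx ▸ hR x)
    rw [this, measureReal_empty]
  let q : ι → ℝ := fun i => if i ∈ D then (2 * (D.card : ℝ))⁻¹ else
    if i ∈ R then (2 * (R.card : ℝ))⁻¹ else 0
  have hq := labelEntropy_le_neg_sum (μ := μ) hf (q := q)
    (fun i => by simp only [q]; split_ifs <;> positivity)
    (fun i hi => by
      simp only [q] at hi
      split_ifs at hi with h1 h2
      · exact absurd hi (by positivity)
      · exact absurd hi (by positivity)
      · exact hzero i h2)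
    (by
      calc ∑ i, q i ≤ ∑ i, ((if i ∈ D then (2 * (D.card : ℝ))⁻¹ else 0) +
            (if i ∈ R then (2 * (R.card : ℝ))⁻¹ else 0)) := by
            refine Finset.sum_le_sum fun i _ => ?_
            simp only [q]
            split_ifs <;> simp
        _ = 1 := by
            rw [Finset.sum_add_distrib, Finset.sum_ite_mem, Finset.sum_ite_mem,
              Finset.univ_inter, Finset.univ_inter, Finset.sum_const, Finset.sum_const,
              nsmul_eq_mul, nsmul_eq_mul]
            field_simp
            norm_num)
  have hterm : ∀ i, -(μ.real (f ⁻¹' {i}) * Real.log (q i)) =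
      μ.real (f ⁻¹' {i}) * (Real.log 2 + Real.log R.card) +
        (if i ∈ D then μ.real (f ⁻¹' {i}) * (Real.log D.card - Real.log R.card) else 0) := by
    intro i
    simp only [q]
    split_ifs with h1 h2
    · rw [Real.log_inv, Real.log_mul two_ne_zero hd.ne']; ring
    · rw [Real.log_inv, Real.log_mul two_ne_zero hr.ne']; ring
    · rw [hzero i h2]; simp
  rw [← Finset.sum_neg_distrib, Finset.sum_congr rfl fun i _ => hterm i, Finset.sum_add_distrib,
    ← Finset.sum_mul, sum_measureReal_preimage_singleton hf, Finset.sum_ite_mem,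
    Finset.univ_inter, ← Finset.sum_mul, ← measureReal_preimage_eq_sum hf] at hq
  linarith

end EntropyBounds

/-! ### Periodic points -/

section Periodic

variable {Ω : Type*} {T : Ω → Ω}

theorem mapsTo_per (n : ℕ) : MapsTo T (Per T n) (Per T n) := fun _ ⟨k, h1, h2, hk⟩ =>
  ⟨k, h1, h2, hk.apply⟩

theorem per_subset_periodicPts (n : ℕ) : Per T n ⊆ Function.periodicPts T :=
  fun _ ⟨k, h1, _, hk⟩ => ⟨k, h1, hk⟩

theorem per_eq_biUnion (n : ℕ) :
    Per T n = ⋃ k ∈ Finset.Icc 1 n, {x | Function.IsPeriodicPt T k x} := by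
  ext x
  simp [Per, and_assoc]

/-- `T` permutes `Per T n`, with `T^[k - 1]` as inverse on points of period `k`. This makes the
periodic-orbit measures invariant. -/
theorem ncard_per_inter_preimage (n : ℕ) (E : Set Ω) :
    (Per T n ∩ T ⁻¹' E).ncard = (Per T n ∩ E).ncard := by
  refine ncard_congr (fun x _ => T x) (fun x hx => ⟨mapsTo_per n hx.1, hx.2⟩)
    (fun x y hx hy hxy => (Function.bijOn_periodicPts T).injOn
      (per_subset_periodicPts n hx.1) (per_subset_periodicPts n hy.1) hxy) ?_
  rintro y ⟨⟨k, h1, h2, hk⟩, hy⟩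
  have hk' : T (T^[k - 1] y) = y := by
    rw [← Function.iterate_succ_apply' T, Nat.succ_eq_add_one, Nat.sub_add_cancel h1]
    exact hk
  exact ⟨T^[k - 1] y, ⟨⟨k, h1, h2, hk.apply_iterate _⟩, by simpa [hk'] using hy⟩, hk'⟩

variable [MeasurableSpace Ω]

theorem perMeasure_apply {n : ℕ} (hfin : (Per T n).Finite) {E : Set Ω} (hE : MeasurableSet E) :
    perMeasure T n E = ((Per T n).ncard : ℝ≥0∞)⁻¹ * (Per T n ∩ E).ncard := by
  classical
  have := hfin.fintype
  rw [perMeasure, Measure.smul_apply, Measure.sum_apply _ hE, smul_eq_mul, tsum_fintype]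
  congr 1
  simp only [Measure.dirac_apply' _ hE, indicator_apply, Pi.one_apply]
  rw [Finset.sum_boole, ← ncard_coe_finset]
  congr 1
  refine ncard_congr (fun x _ => (x : Ω)) (fun x hx => ⟨x.2, by simpa using hx⟩)
    (fun x y _ _ h => Subtype.ext h) ?_
  rintro y ⟨hy, hyE⟩
  exact ⟨⟨y, hy⟩, by simpa using hyE, rfl⟩

theorem isProbabilityMeasure_perMeasure {n : ℕ} (hfin : (Per T n).Finite)
    (hne : (Per T n).Nonempty) : IsProbabilityMeasure (perMeasure T n) := by
  constructor
  rw [perMeasure_apply hfin MeasurableSet.univ, inter_univ]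
  exact ENNReal.inv_mul_cancel (by exact_mod_cast ((ncard_pos hfin).2 hne).ne')
    (ENNReal.natCast_ne_top _)

theorem measureReal_perMeasure {n : ℕ} (hfin : (Per T n).Finite) {E : Set Ω}
    (hE : MeasurableSet E) :
    (perMeasure T n).real E = (Per T n ∩ E).ncard / (Per T n).ncard := by
  rw [Measure.real, perMeasure_apply hfin hE, ENNReal.toReal_mul, ENNReal.toReal_inv,
    ENNReal.toReal_natCast, ENNReal.toReal_natCast, mul_comm, div_eq_mul_inv]

theorem measurePreserving_perMeasure {n : ℕ} (hfin : (Per T n).Finite) (hT : Measurable T) :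
    MeasurePreserving T (perMeasure T n) (perMeasure T n) := by
  refine ⟨hT, Measure.ext fun E hE => ?_⟩
  rw [Measure.map_apply hT hE, perMeasure_apply hfin (hT hE), perMeasure_apply hfin hE,
    ncard_per_inter_preimage]

end Periodic

/-! ### Counting periodic points of a coded system -/

namespace CodedSystem

variable {A Ω : Type*} {p : ℕ} {T : Ω → Ω} {α : Ω → Fin p} {h : ℝ}

theorem injOn_itinerary (c : CodedSystem A T α) {k : ℕ} (hk : 1 ≤ k) :
    InjOn (itinerary T α k) {x | Function.IsPeriodicPt T k x} :=
  fun x hx y hy hxy => c.eq_of_periodic x y k hk hx hy hxy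

theorem finite_isPeriodicPt (c : CodedSystem A T α) {k : ℕ} (hk : 1 ≤ k) :
    {x | Function.IsPeriodicPt T k x}.Finite :=
  Finite.of_finite_image (toFinite _) (c.injOn_itinerary hk)

theorem finite_per (c : CodedSystem A T α) (n : ℕ) : (Per T n).Finite := by
  rw [per_eq_biUnion]
  exact (Finset.finite_toSet _).biUnion fun k hk =>
    c.finite_isPeriodicPt (Finset.mem_Icc.1 (Finset.mem_coe.1 hk)).1

/-- A point of period `k` is determined by its first `k` labels. If `m` of them are fixed, at most
`wordCount T α (k - m)` choices remain; if `k < m` there is at most one point, which accounts for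
the summand `1`. -/
theorem ncard_isPeriodicPt_inter_le (c : CodedSystem A T α) {C : ℝ} (hC : 0 ≤ C)
    (hbound : ∀ n : ℕ, (wordCount T α n : ℝ) ≤ C * Real.exp (n * h)) {k : ℕ} (hk : 1 ≤ k) {m : ℕ}
    (w : Fin m → Fin p) :
    (({x | Function.IsPeriodicPt T k x} ∩ itinerary T α m ⁻¹' {w}).ncard : ℝ) ≤
      1 + C * Real.exp (-(m * h)) * Real.exp (k * h) := by
  have hpos : 0 ≤ C * Real.exp (-(m * h)) * Real.exp (k * h) := by positivity
  rcases lt_or_ge k m with hlt | hle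
  · have : ({x | Function.IsPeriodicPt T k x} ∩ itinerary T α m ⁻¹' {w}).ncard ≤ 1 := by
      refine (ncard_le_one ((c.finite_isPeriodicPt hk).inter_of_left _)).2
        fun x hx y hy => c.injOn_itinerary hk hx.1 hy.1 ?_
      have hxy : itinerary T α m x = itinerary T α m y :=
        (show _ = w from hx.2).trans (show _ = w from hy.2).symm
      exact itinerary_eq_iff.2 fun i hi => itinerary_eq_iff.1 hxy i (by omega)
    have : (({x | Function.IsPeriodicPt T k x} ∩ itinerary T α m ⁻¹' {w}).ncard : ℝ) ≤ 1 := by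
      exact_mod_cast this
    linarith
  · have h1 : ({x | Function.IsPeriodicPt T k x} ∩ itinerary T α m ⁻¹' {w}).ncard ≤
        wordCount T α (k - m) := by
      refine ncard_le_ncard_of_injOn (fun x => itinerary T α (k - m) (T^[m] x))
        (fun x _ => ⟨_, rfl⟩) (fun x hx y hy hxy => c.injOn_itinerary hk hx.1 hy.1 ?_)
        (toFinite _)
      have hxy' : itinerary T α m x = itinerary T α m y :=
        (show _ = w from hx.2).trans (show _ = w from hy.2).symm
      refine itinerary_eq_iff.2 fun i hi => ?_
      rcases lt_or_ge i m with him | him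
      · exact itinerary_eq_iff.1 hxy' i him
      · have := itinerary_eq_iff.1 hxy (i - m) (by omega)
        rwa [← Function.iterate_add_apply, ← Function.iterate_add_apply,
          Nat.sub_add_cancel him] at this
    have h2 := hbound (k - m)
    have h3 : ((k - m : ℕ) : ℝ) * h = -(m * h) + k * h := by rw [Nat.cast_sub hle]; ring
    rw [h3, Real.exp_add, ← mul_assoc] at h2
    have h4 : (({x | Function.IsPeriodicPt T k x} ∩ itinerary T α m ⁻¹' {w}).ncard : ℝ) ≤
        wordCount T α (k - m) := by exact_mod_cast h1
    linarith

theorem sum_exp_le (hpos : 0 < h) (N : ℕ) :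
    ∑ k ∈ Finset.Icc 1 N, Real.exp (k * h) ≤ (1 - Real.exp (-h))⁻¹ * Real.exp (N * h) := by
  have hlt : Real.exp (-h) < 1 := Real.exp_lt_one_iff.2 (by linarith)
  have hpos' : 0 < 1 - Real.exp (-h) := by linarith
  rw [inv_mul_eq_div, le_div_iff₀ hpos']
  induction N with
  | zero => simp
  | succ N ih =>
    rw [Finset.sum_Icc_succ_top (by omega), add_mul]
    have : Real.exp ((N + 1 : ℕ) * h) * Real.exp (-h) = Real.exp (N * h) := by
      rw [← Real.exp_add]; congr 1; push_cast; ring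
    rw [mul_sub (Real.exp _), mul_one, this]
    linarith

theorem exists_ncard_per_inter_le (c : CodedSystem A T α) (hh : IsGrowthRate T α h) (hpos : 0 < h) :
    ∃ C > 0, ∀ (m : ℕ) (w : Fin m → Fin p) (N : ℕ),
      ((Per T N ∩ itinerary T α m ⁻¹' {w}).ncard : ℝ) ≤
        N + C * Real.exp (-(m * h)) * Real.exp (N * h) := by
  obtain ⟨C, hC, hbound⟩ := c.exists_wordCount_le hh hpos
  have hlt : Real.exp (-h) < 1 := Real.exp_lt_one_iff.2 (by linarith)
  have hpos' : 0 < (1 - Real.exp (-h))⁻¹ := inv_pos.2 (by linarith)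
  refine ⟨C * (1 - Real.exp (-h))⁻¹, by positivity, fun m w N => ?_⟩
  have h1 : ((Per T N ∩ itinerary T α m ⁻¹' {w}).ncard : ℝ) ≤ ∑ k ∈ Finset.Icc 1 N,
      (({x | Function.IsPeriodicPt T k x} ∩ itinerary T α m ⁻¹' {w}).ncard : ℝ) := by
    rw [per_eq_biUnion, iUnion₂_inter]
    exact_mod_cast Finset.set_ncard_biUnion_le _ _
  calc _ ≤ _ := h1
    _ ≤ ∑ k ∈ Finset.Icc 1 N, (1 + C * Real.exp (-(m * h)) * Real.exp (k * h)) :=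
        Finset.sum_le_sum fun k hk => c.ncard_isPeriodicPt_inter_le (by linarith) hbound
          (Finset.mem_Icc.1 hk).1 w
    _ = N + C * Real.exp (-(m * h)) * ∑ k ∈ Finset.Icc 1 N, Real.exp (k * h) := by
        rw [Finset.sum_add_distrib, Finset.mul_sum]; simp
    _ ≤ N + C * Real.exp (-(m * h)) * ((1 - Real.exp (-h))⁻¹ * Real.exp (N * h)) := by
        gcongr
        exact sum_exp_le hpos N
    _ = _ := by ring

theorem exists_ncard_per_le (c : CodedSystem A T α) (hh : IsGrowthRate T α h) (hpos : 0 < h) :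
    ∃ C > 0, ∀ N : ℕ, ((Per T N).ncard : ℝ) ≤ C * Real.exp (N * h) := by
  obtain ⟨C, hC, H⟩ := c.exists_ncard_per_inter_le hh hpos
  refine ⟨h⁻¹ + C, by positivity, fun N => ?_⟩
  -- The empty word imposes no condition; the summand `N` is absorbed by `N h + 1 ≤ exp (N h)`.
  have h1 := H 0 (fun i => i.elim0) N
  have h2 : itinerary T α 0 ⁻¹' {fun i => i.elim0} = univ :=
    eq_univ_of_forall fun x => Subsingleton.elim _ _
  rw [h2, inter_univ] at h1
  have h3 : (N : ℝ) ≤ h⁻¹ * Real.exp (N * h) := by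
    rw [inv_mul_eq_div, le_div_iff₀ hpos]
    linarith [Real.add_one_le_exp (N * h)]
  simp only [Nat.cast_zero, zero_mul, neg_zero, Real.exp_zero, mul_one] at h1
  linarith

theorem exists_le_ncard_per (c : CodedSystem A T α) (hh : IsGrowthRate T α h) (hpos : 0 < h) :
    ∃ κ > 0, ∀ᶠ N : ℕ in atTop, κ * Real.exp (N * h) ≤ (Per T N).ncard := by
  obtain ⟨κ, hκ, H⟩ := c.exists_codeCount_ge hh hpos
  refine ⟨κ, hκ, ?_⟩
  -- For large `N` the lower bound exceeds `codeCount 0 = 1`, so the words to be repeated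
  -- periodically are nonempty.
  have ht : Tendsto (fun N : ℕ => κ * Real.exp (N * h)) atTop atTop :=
    (Real.tendsto_exp_atTop.comp
      (tendsto_natCast_atTop_atTop.atTop_mul_const hpos)).const_mul_atTop hκ
  filter_upwards [ht.eventually_gt_atTop 1] with N hN
  obtain ⟨j, hj, hcount⟩ := H N
  have hj0 : j ≠ 0 := by
    rintro rfl
    rw [codeCount_zero, Nat.cast_one] at hcount
    linarith
  refine hcount.trans ?_
  have : c.codeCount j ≤ (Per T N).ncard := by
    refine (ncard_le_ncard (t := itinerary T α (j - c.r) '' Per T N) ?_ (toFinite _)).trans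
      (ncard_image_le (c.finite_per N))
    rintro _ ⟨v, ⟨hv, hvj⟩, rfl⟩
    obtain ⟨x, hx, hxv⟩ := c.realize v hv (by rintro rfl; exact hj0 hvj.symm)
    rw [hvj] at hx
    exact ⟨x, ⟨j, by omega, hj, hx⟩, funext fun i => hxv i (by omega)⟩
  exact_mod_cast this

/-- Many periodic points visit two large sets of words at prescribed times. -/
theorem exists_le_ncard_per_two (c : CodedSystem A T α) (hh : IsGrowthRate T α h)
    (hpos : 0 < h) {δ : ℝ} (hδ : 0 < δ) :
    ∃ κ > 0, ∀ n : ℕ, 1 ≤ n → ∀ D₁ D₂ : Set (Fin n → Fin p), D₁ ⊆ range (itinerary T α n) →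
      D₂ ⊆ range (itinerary T α n) → δ * Real.exp (n * h) ≤ D₁.ncard →
      δ * Real.exp (n * h) ≤ D₂.ncard → ∃ a k : ℕ, ∀ᶠ N : ℕ in atTop,
        κ * Real.exp (N * h) ≤ (Per T N ∩ T^[a] ⁻¹' (itinerary T α n ⁻¹' D₁ ∩
          T^[k] ⁻¹' (itinerary T α n ⁻¹' D₂))).ncard := by
  obtain ⟨κ, hκ, H⟩ := c.exists_codeCount_ge hh hpos
  obtain ⟨κ', hκ', τ, H'⟩ := c.exists_good_subset hh hpos hδ
  -- Periodic points repeat `U₁ U₂ u`, with `U₁`, `U₂` containing the two words and `u` a free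
  -- filler bringing the period to at most `N`. The factor `exp (-2 τ h)` pays for `m₁, m₂ ≤ n + τ`.
  -- The constant does not depend on `n`.
  refine ⟨κ' * κ' * κ * Real.exp (-(2 * τ * h)), by positivity,
    fun n hn D₁ D₂ hD₁ hD₂ hc₁ hc₂ => ?_⟩
  obtain ⟨a₁, m₁, ham₁, hm₁, E₁, hE₁, hcE₁, hV₁⟩ := H' n D₁ hD₁ hc₁
  obtain ⟨a₂, m₂, ham₂, hm₂, E₂, hE₂, hcE₂, hV₂⟩ := H' n D₂ hD₂ hc₂
  refine ⟨a₁, m₁ + a₂ - a₁, ?_⟩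
  filter_upwards [eventually_ge_atTop (m₁ + m₂)] with N hN
  obtain ⟨j, hj, hcount⟩ := H (N - (m₁ + m₂))
  set S := Per T N ∩ T^[a₁] ⁻¹' (itinerary T α n ⁻¹' D₁ ∩
    T^[m₁ + a₂ - a₁] ⁻¹' (itinerary T α n ⁻¹' D₂)) with hS
  have hSfin : S.Finite := (c.finite_per N).inter_of_left _
  have hcard : E₁.ncard * (E₂.ncard * c.codeCount j) ≤ S.ncard := by
    unfold codeCount
    rw [← ncard_prod, ← ncard_prod]
    refine (ncard_le_ncard (t := (fun x => (itinerary T α n (T^[a₁] x),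
      (itinerary T α n (T^[m₁ + a₂] x), itinerary T α (j - c.r) (T^[m₁ + m₂] x)))) '' S) ?_
      (hSfin.image _)).trans (ncard_image_le hSfin)
    rintro ⟨w₁, w₂, w₃⟩ ⟨hw₁, hw₂, ⟨u, ⟨hu, huj⟩, hw₃⟩⟩
    obtain ⟨U₁, hU₁, hl₁, hUw₁⟩ := hV₁ w₁ hw₁
    obtain ⟨U₂, hU₂, hl₂, hUw₂⟩ := hV₂ w₂ hw₂
    have hlen : (U₁ ++ U₂ ++ u).length = m₁ + m₂ + j := by
      simp [hl₁, hl₂, huj, add_assoc]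
    obtain ⟨x, hx, hxV⟩ := c.realize (U₁ ++ U₂ ++ u)
      (c.append_mem (c.append_mem hU₁ hU₂) hu) (by
        rw [← List.length_pos_iff, hlen]; omega)
    rw [hlen] at hx hxV
    have e₁ : itinerary T α n (T^[a₁] x) = w₁ := by
      funext i
      have hi := i.2
      have e := List.take_drop_append_append [] U₁ (U₂ ++ u) (j := a₁ + i) (l := c.r + 1)
        (by omega)
      simp only [List.nil_append, List.length_nil, zero_add, ← List.append_assoc] at e
      rw [itinerary, ← Function.iterate_add_apply, hUw₁, add_comm, hxV _ (by omega), e]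
    have e₂ : itinerary T α n (T^[m₁ + a₂] x) = w₂ := by
      funext i
      have hi := i.2
      have e := List.take_drop_append_append U₁ U₂ u (j := a₂ + i) (l := c.r + 1) (by omega)
      rw [hl₁] at e
      rw [itinerary, ← Function.iterate_add_apply, hUw₂, add_comm, hxV _ (by omega), add_assoc, e]
    have e₃ : itinerary T α (j - c.r) (T^[m₁ + m₂] x) = w₃ := by
      rw [← show _ = w₃ from hw₃]
      funext i
      have hi := i.2
      have e := List.take_drop_append_append (U₁ ++ U₂) u [] (j := i) (l := c.r + 1) (by omega)
      rw [List.append_nil, List.length_append, hl₁, hl₂] at e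
      rw [itinerary, ← Function.iterate_add_apply, add_comm, hxV _ (by omega), e]
      rfl
    refine ⟨x, ⟨⟨m₁ + m₂ + j, by omega, by omega, hx⟩, ?_, ?_⟩, ?_⟩
    · rw [mem_preimage, e₁]
      exact hE₁ hw₁
    · rw [mem_preimage, mem_preimage, ← Function.iterate_add_apply,
        Nat.sub_add_cancel (by omega), e₂]
      exact hE₂ hw₂
    · exact Prod.ext e₁ (Prod.ext e₂ e₃)
  have hcard' : (E₁.ncard : ℝ) * (E₂.ncard * c.codeCount j) ≤ S.ncard := by exact_mod_cast hcard
  refine le_trans ?_ hcard'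
  have hexp : Real.exp (-(2 * τ * h)) * Real.exp (N * h) ≤
      Real.exp (n * h) * (Real.exp (n * h) * Real.exp ((N - (m₁ + m₂) : ℕ) * h)) := by
    rw [← Real.exp_add, ← Real.exp_add, ← Real.exp_add, Real.exp_le_exp, Nat.cast_sub hN]
    have h1 : (m₁ : ℝ) ≤ n + τ := by exact_mod_cast hm₁
    have h2 : (m₂ : ℝ) ≤ n + τ := by exact_mod_cast hm₂
    push_cast
    nlinarith
  calc κ' * κ' * κ * Real.exp (-(2 * τ * h)) * Real.exp (N * h)
      = κ' * κ' * κ * (Real.exp (-(2 * τ * h)) * Real.exp (N * h)) := by ring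
    _ ≤ κ' * κ' * κ *
        (Real.exp (n * h) * (Real.exp (n * h) * Real.exp ((N - (m₁ + m₂) : ℕ) * h))) := by gcongr
    _ = κ' * Real.exp (n * h) *
        (κ' * Real.exp (n * h) * (κ * Real.exp ((N - (m₁ + m₂) : ℕ) * h))) := by ring
    _ ≤ _ := by gcongr

end CodedSystem

/-! ### Measures of maximal entropy of a coded system -/

namespace CodedSystem

variable {A Ω : Type*} {p : ℕ} {T : Ω → Ω} {α : Ω → Fin p} {h : ℝ} [mΩ : MeasurableSpace Ω]

theorem measureEntropy_le_of_isGrowthRate (hh : IsGrowthRate T α h)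
    (hgen : mΩ = MeasurableSpace.generateFrom (readableSets T α)) (hα : Measurable α)
    {ν : Measure Ω} [IsProbabilityMeasure ν] (hν : MeasurePreserving T ν ν) :
    measureEntropy T ν ≤ (h : EReal) := by
  obtain ⟨x₀⟩ := nonempty_of_isProbabilityMeasure ν
  -- The `log 2` comes from the counting bound applied with `D = R` and disappears after division by
  -- `n`.
  have ht : Tendsto (fun n : ℕ => ((Real.log 2 / n + Real.log (wordCount T α n) / n : ℝ) : EReal))
      atTop (𝓝 ((0 + h : ℝ) : EReal)) :=
    (continuous_coe_real_ereal.tendsto _).comp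
      ((tendsto_const_div_atTop_nhds_zero_nat _).add hh.tendsto)
  rw [zero_add] at ht
  refine ge_of_tendsto ht ?_
  filter_upwards [eventually_ne_atTop 0] with n hn
  refine (measureEntropy_le_of_generating hgen hα hν hn).trans (EReal.coe_le_coe_iff.2 ?_)
  have hn' : (0 : ℝ) < n := by exact_mod_cast Nat.pos_of_ne_zero hn
  rw [← add_div]
  gcongr
  have := labelEntropy_le_of_subset (μ := ν) (measurable_itinerary hν.measurable hα n)
    (subset_refl (range (itinerary T α n))) ⟨_, x₀, rfl⟩ fun x => ⟨x, rfl⟩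
  rw [← wordCount] at this
  linarith

/-- For an invariant measure of entropy at least `h`, a set of words of measure at least `a`
contains at least a positive fraction, depending only on `a`, of `exp (n h)` words. -/
theorem exists_le_ncard_of_labelEntropy_ge (c : CodedSystem A T α) (hh : IsGrowthRate T α h)
    (hpos : 0 < h) (hT : Measurable T) (hα : Measurable α) {a : ℝ} (ha : 0 < a) :
    ∃ δ > 0, ∀ (ν : Measure Ω) [IsProbabilityMeasure ν] (n : ℕ),
      n * h ≤ labelEntropy ν (itinerary T α n) → ∀ D ⊆ range (itinerary T α n),
        a ≤ ν.real (itinerary T α n ⁻¹' D) → δ * Real.exp (n * h) ≤ D.ncard := by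
  obtain ⟨C, hC, hbound⟩ := c.exists_wordCount_le hh hpos
  -- With `t` the measure of `D`, `n h ≤ log 2 + t log |D| + (1 - t)(log C + n h)` gives `log |D| ≥
  -- n h - log (2 C) / t`, and `t ≥ a`.
  refine ⟨Real.exp (-(Real.log (2 * C) / a)), Real.exp_pos _, fun ν _ n hent D hD haD => ?_⟩
  have := c.nonempty
  have hne : D.Nonempty := by
    by_contra hne
    rw [not_nonempty_iff_eq_empty.1 hne, preimage_empty, measureReal_empty] at haD
    linarith
  have hdpos : (0 : ℝ) < D.ncard := by exact_mod_cast (ncard_pos (toFinite D)).2 hne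
  have hle := labelEntropy_le_of_subset (μ := ν) (measurable_itinerary hT hα n) hD hne
    fun x => ⟨x, rfl⟩
  rw [← wordCount] at hle
  set t := ν.real (itinerary T α n ⁻¹' D) with ht
  have ht1 : t ≤ 1 := measureReal_le_one
  have hw : Real.log (wordCount T α n) ≤ Real.log C + n * h := by
    have hw0 : (0 : ℝ) < wordCount T α n := by exact_mod_cast wordCount_pos n
    have := Real.log_le_log hw0 (hbound n)
    rwa [Real.log_mul (by linarith) (Real.exp_pos _).ne', Real.log_exp] at this
  have hlogC : 0 ≤ Real.log C := Real.log_nonneg hC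
  have hlog2 : 0 < Real.log 2 := Real.log_pos one_lt_two
  have h2C : Real.log (2 * C) = Real.log 2 + Real.log C :=
    Real.log_mul two_ne_zero (by linarith)
  rw [← Real.exp_add, ← Real.le_log_iff_exp_le hdpos]
  have h1 := mul_le_mul_of_nonneg_left hw (sub_nonneg.2 ht1)
  have h2 : -Real.log (2 * C) ≤ t * (Real.log D.ncard - n * h) := by
    rw [h2C]; nlinarith
  have htpos : 0 < t := ha.trans_le haD
  have h3 : -Real.log (2 * C) / t ≤ Real.log D.ncard - n * h := by
    rw [div_le_iff₀ htpos]; linarith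
  have h4 : Real.log (2 * C) / t ≤ Real.log (2 * C) / a := by
    gcongr
    rw [h2C]; positivity
  rw [neg_div] at h3
  linarith

theorem isClopen_preimage_itinerary {Ω : Type*} [TopologicalSpace Ω] {T : Ω → Ω}
    {α : Ω → Fin p} (hT : Continuous T) (hα : Continuous α) (n : ℕ)
    (D : Set (Fin n → Fin p)) : IsClopen (itinerary T α n ⁻¹' D) :=
  (isClopen_discrete D).preimage (continuous_pi fun i => hα.comp (hT.iterate i))

variable [TopologicalSpace Ω] [BorelSpace Ω]

variable {μ : ProbabilityMeasure Ω} {ν : ℕ → ProbabilityMeasure Ω} {l : Filter ℕ}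

/-! ### Weak* limits of the periodic-orbit measures. -/

section Limit

variable [HasOuterApproxClosed Ω]

theorem measurePreserving_of_tendsto [l.NeBot] (c : CodedSystem A T α) (hT : Continuous T)
    (hν : ∀ n, 1 ≤ n → (ν n : Measure Ω) = perMeasure T n) (hl : l ≤ atTop)
    (hμ : Tendsto ν l (𝓝 μ)) : MeasurePreserving T (μ : Measure Ω) μ := by
  have h1 := ProbabilityMeasure.tendsto_map_of_tendsto_of_continuous ν μ hμ hT
  have h2 : ∀ᶠ n in l, (ν n).map hT.measurable.aemeasurable = ν n := by
    filter_upwards [hl (eventually_ge_atTop 1)] with n hn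
    refine ProbabilityMeasure.toMeasure_injective ?_
    rw [ProbabilityMeasure.toMeasure_map, hν n hn]
    exact (measurePreserving_perMeasure (c.finite_per n) hT.measurable).map_eq
  have h3 := tendsto_nhds_unique (h1.congr' h2) hμ
  refine ⟨hT.measurable, ?_⟩
  rw [← ProbabilityMeasure.toMeasure_map μ hT.measurable.aemeasurable, h3]

theorem tendsto_measureReal_of_isClopen (c : CodedSystem A T α)
    (hν : ∀ n, 1 ≤ n → (ν n : Measure Ω) = perMeasure T n) (hl : l ≤ atTop)
    (hμ : Tendsto ν l (𝓝 μ)) {E : Set Ω} (hE : IsClopen E) :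
    Tendsto (fun n => ((Per T n ∩ E).ncard : ℝ) / (Per T n).ncard) l
      (𝓝 ((μ : Measure Ω).real E)) := by
  have h1 := ProbabilityMeasure.tendsto_measure_of_isClopen_of_tendsto hμ hE
  have h2 := (NNReal.continuous_coe.tendsto _).comp h1
  rw [← ProbabilityMeasure.measureReal_eq_coe_coeFn] at h2
  refine h2.congr' ?_
  filter_upwards [hl (eventually_ge_atTop 1)] with n hn
  rw [Function.comp_apply, ← ProbabilityMeasure.measureReal_eq_coe_coeFn, hν n hn,
    measureReal_perMeasure (c.finite_per n) hE.isOpen.measurableSet]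

/-- The upper Gibbs bound. -/
theorem exists_measureReal_le_exp (c : CodedSystem A T α) (hh : IsGrowthRate T α h)
    (hpos : 0 < h) (hT : Continuous T) (hα : Continuous α) :
    ∃ C > 0, ∀ (ν : ℕ → ProbabilityMeasure Ω) (μ : ProbabilityMeasure Ω) (l : Filter ℕ) [l.NeBot],
      (∀ n, 1 ≤ n → (ν n : Measure Ω) = perMeasure T n) → l ≤ atTop → Tendsto ν l (𝓝 μ) →
      ∀ (m : ℕ) (w : Fin m → Fin p),
        (μ : Measure Ω).real (itinerary T α m ⁻¹' {w}) ≤ C * Real.exp (-(m * h)) := by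
  obtain ⟨C, hC, hup⟩ := c.exists_ncard_per_inter_le hh hpos
  obtain ⟨κ, hκ, hlow⟩ := c.exists_le_ncard_per hh hpos
  refine ⟨C / κ, by positivity, fun ν μ l _ hν hl hμ m w => ?_⟩
  have h1 := c.tendsto_measureReal_of_isClopen hν hl hμ
    (isClopen_preimage_itinerary hT hα m {w})
  -- Divided by `#Per(N) ≥ κ exp (N h)`, the linear term in the cylinder count vanishes and only the
  -- Gibbs term survives.
  have h2 : Tendsto (fun N : ℕ => κ⁻¹ * (h⁻¹ * (((N : ℝ) * h) ^ 1 * Real.exp (-(N * h))) +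
      C * Real.exp (-(m * h)))) l
      (𝓝 (κ⁻¹ * (h⁻¹ * 0 + C * Real.exp (-(m * h))))) := by
    have := (Real.tendsto_pow_mul_exp_neg_atTop_nhds_zero 1).comp
      (tendsto_natCast_atTop_atTop.atTop_mul_const hpos)
    exact (((this.mono_left hl).const_mul _).add_const _).const_mul _
  have h3 : κ⁻¹ * (h⁻¹ * 0 + C * Real.exp (-(m * h))) = C / κ * Real.exp (-(m * h)) := by
    field_simp; ring
  rw [h3] at h2
  refine le_of_tendsto_of_tendsto h1 h2 ?_
  filter_upwards [hl hlow] with N hN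
  have hE := Real.exp_pos (N * h)
  calc ((Per T N ∩ itinerary T α m ⁻¹' {w}).ncard : ℝ) / (Per T N).ncard
      ≤ (N + C * Real.exp (-(m * h)) * Real.exp (N * h)) / (κ * Real.exp (N * h)) := by
        gcongr
        exact hup m w N
    _ = _ := by
        rw [Real.exp_neg (N * h)]
        field_simp

/-- The gluing estimate passes to the limit because the sets are clopen; the starting time `a`
disappears by invariance. The essential point is that `κ` is uniform in `n`. -/
theorem exists_le_measureReal_inter [l.NeBot] (c : CodedSystem A T α) (hh : IsGrowthRate T α h)
    (hpos : 0 < h) (hT : Continuous T) (hα : Continuous α) {δ : ℝ} (hδ : 0 < δ)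
    (hν : ∀ n, 1 ≤ n → (ν n : Measure Ω) = perMeasure T n) (hl : l ≤ atTop)
    (hμ : Tendsto ν l (𝓝 μ)) :
    ∃ κ > 0, ∀ n : ℕ, 1 ≤ n → ∀ D₁ D₂ : Set (Fin n → Fin p), D₁ ⊆ range (itinerary T α n) →
      D₂ ⊆ range (itinerary T α n) → δ * Real.exp (n * h) ≤ D₁.ncard →
      δ * Real.exp (n * h) ≤ D₂.ncard → ∃ k : ℕ,
        κ ≤ (μ : Measure Ω).real (itinerary T α n ⁻¹' D₁ ∩ T^[k] ⁻¹' (itinerary T α n ⁻¹' D₂)) := by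
  obtain ⟨κ, hκ, H⟩ := c.exists_le_ncard_per_two hh hpos hδ
  obtain ⟨C, hC, hup⟩ := c.exists_ncard_per_le hh hpos
  refine ⟨κ / C, by positivity, fun n hn D₁ D₂ hD₁ hD₂ hc₁ hc₂ => ?_⟩
  obtain ⟨a, k, hev⟩ := H n hn D₁ D₂ hD₁ hD₂ hc₁ hc₂
  refine ⟨k, ?_⟩
  have hclopen : IsClopen (itinerary T α n ⁻¹' D₁ ∩ T^[k] ⁻¹' (itinerary T α n ⁻¹' D₂)) :=
    (isClopen_preimage_itinerary hT hα n D₁).inter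
      ((isClopen_preimage_itinerary hT hα n D₂).preimage (hT.iterate k))
  have hinv := c.measurePreserving_of_tendsto hT hν hl hμ
  rw [← (hinv.iterate a).measureReal_preimage hclopen.isOpen.measurableSet.nullMeasurableSet]
  refine ge_of_tendsto (c.tendsto_measureReal_of_isClopen hν hl hμ
    (hclopen.preimage (hT.iterate a))) ?_
  filter_upwards [hl hev] with N hN
  have hpp : (0 : ℝ) < (Per T N).ncard := by
    have h1 : (0 : ℝ) < κ * Real.exp (N * h) := by positivity
    refine (h1.trans_le hN).trans_le ?_
    exact_mod_cast ncard_le_ncard inter_subset_left (c.finite_per N)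
  rw [div_le_div_iff₀ hC hpp]
  calc κ * (Per T N).ncard ≤ κ * (C * Real.exp (N * h)) := by gcongr; exact hup N
    _ = κ * Real.exp (N * h) * C := by ring
    _ ≤ _ := by gcongr

/-- By the upper Gibbs bound every word of length `n` and positive measure has information at least
`n h - log C`; average and divide by `n`. -/
theorem le_measureEntropy_of_tendsto [l.NeBot] (c : CodedSystem A T α) (hh : IsGrowthRate T α h)
    (hpos : 0 < h) (hT : Continuous T) (hα : Continuous α)
    (hν : ∀ n, 1 ≤ n → (ν n : Measure Ω) = perMeasure T n) (hl : l ≤ atTop)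
    (hμ : Tendsto ν l (𝓝 μ)) : (h : EReal) ≤ measureEntropy T (μ : Measure Ω) := by
  obtain ⟨C, hC, H⟩ := c.exists_measureReal_le_exp hh hpos hT hα
  have hgibbs := H ν μ l hν hl hμ
  have hent : ∀ n : ℕ, n * h - Real.log C ≤ joinEntropy T μ α n := by
    intro n
    have hmeas := measurable_itinerary hT.measurable hα.measurable n
    rw [joinEntropy_eq_labelEntropy]
    calc n * h - Real.log C
        = ∑ w, (μ : Measure Ω).real (itinerary T α n ⁻¹' {w}) * (n * h - Real.log C) := by
          rw [← Finset.sum_mul, sum_measureReal_preimage_singleton hmeas, one_mul]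
      _ ≤ _ := by
          refine Finset.sum_le_sum fun w _ => ?_
          rw [Real.negMulLog, neg_mul, ← mul_neg]
          rcases (measureReal_nonneg (μ := (μ : Measure Ω))
            (s := itinerary T α n ⁻¹' {w})).eq_or_lt with h0 | h0
          · rw [← h0]; simp
          refine mul_le_mul_of_nonneg_left ?_ h0.le
          have := Real.log_le_log h0 (hgibbs n w)
          rw [Real.log_mul hC.ne' (Real.exp_pos _).ne', Real.log_exp] at this
          linarith
  have hle : (h : EReal) ≤ partitionEntropy T (μ : Measure Ω) α := by
    have ht : Tendsto (fun n : ℕ => ((h - Real.log C / n : ℝ) : EReal)) atTop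
        (𝓝 ((h - 0 : ℝ) : EReal)) :=
      (continuous_coe_real_ereal.tendsto _).comp
        ((tendsto_const_div_atTop_nhds_zero_nat (Real.log C)).const_sub h)
    rw [sub_zero] at ht
    rw [← ht.limsup_eq]
    refine limsup_le_limsup ?_ (by isBoundedDefault) (by isBoundedDefault)
    filter_upwards [eventually_gt_atTop 0] with n hn
    have hn' : (0 : ℝ) < n := by exact_mod_cast hn
    refine EReal.coe_le_coe_iff.2 ?_
    rw [le_div_iff₀ hn', sub_mul, div_mul_cancel₀ _ hn'.ne']
    linarith [hent n]
  exact hle.trans (le_iSup_of_le p (le_iSup_of_le α (le_iSup_of_le hα.measurable le_rfl)))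

/-- Up to small error, `E₁` and `E₂` are unions of cylinders. Those unions contain a positive
fraction of all words since `ρ₁`, `ρ₂` have large entropy, so gluing applies to them. -/
theorem exists_measureReal_inter_pos [l.NeBot] (c : CodedSystem A T α) (hh : IsGrowthRate T α h)
    (hpos : 0 < h) (hT : Continuous T) (hα : Continuous α)
    (hgen : mΩ = MeasurableSpace.generateFrom (readableSets T α))
    (hν : ∀ n, 1 ≤ n → (ν n : Measure Ω) = perMeasure T n) (hl : l ≤ atTop)
    (hμ : Tendsto ν l (𝓝 μ)) {ρ₁ ρ₂ : Measure Ω} [IsProbabilityMeasure ρ₁]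
    [IsProbabilityMeasure ρ₂] (hρ₁ : MeasurePreserving T ρ₁ ρ₁) (hρ₂ : MeasurePreserving T ρ₂ ρ₂)
    (hent₁ : ∀ n : ℕ, 1 ≤ n → n * h ≤ labelEntropy ρ₁ (itinerary T α n))
    (hent₂ : ∀ n : ℕ, 1 ≤ n → n * h ≤ labelEntropy ρ₂ (itinerary T α n))
    {E₁ E₂ : Set Ω} (hE₁ : MeasurableSet E₁) (hE₂ : MeasurableSet E₂) (h₁ : 0 < ρ₁.real E₁)
    (h₂ : 0 < ρ₂.real E₂) : ∃ k : ℕ, 0 < (μ : Measure Ω).real (E₁ ∩ T^[k] ⁻¹' E₂) := by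
  have hinv := c.measurePreserving_of_tendsto hT hν hl hμ
  set a := min (ρ₁.real E₁) (ρ₂.real E₂) / 2 with ha
  have hapos : 0 < a := by positivity
  have ha₁ : 2 * a ≤ ρ₁.real E₁ := by
    rw [ha]; linarith [min_le_left (ρ₁.real E₁) (ρ₂.real E₂)]
  have ha₂ : 2 * a ≤ ρ₂.real E₂ := by
    rw [ha]; linarith [min_le_right (ρ₁.real E₁) (ρ₂.real E₂)]
  obtain ⟨δ, hδ, Hδ⟩ := c.exists_le_ncard_of_labelEntropy_ge hh hpos hT.measurable hα.measurable
    hapos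
  obtain ⟨κ, hκ, Hκ⟩ := c.exists_le_measureReal_inter hh hpos hT hα hδ hν hl hμ
  -- `κ` depends only on `a` and is fixed before the approximating sets and their word length. The
  -- two approximation errors cost at most `κ / 2`.
  set ε := min a (κ / 4) with hε
  have hεpos : 0 < ε := by positivity
  have happrox : ∀ {E : Set Ω}, MeasurableSet E → ∃ K ∈ readableSets T α, MeasurableSet K ∧
      (μ : Measure Ω).real (symmDiff K E) < ε ∧ ρ₁.real (symmDiff K E) < ε ∧
        ρ₂.real (symmDiff K E) < ε := by
    intro E hE
    -- Approximating for the sum of the three measures is approximating for all of them at once.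
    obtain ⟨K, hK, hKm, hlt⟩ := exists_readable_symmDiff_lt (μ := (μ : Measure Ω) + (ρ₁ + ρ₂))
      hgen hE hεpos
    rw [measureReal_add_apply, measureReal_add_apply] at hlt
    have g1 := measureReal_nonneg (μ := (μ : Measure Ω)) (s := symmDiff K E)
    have g2 := measureReal_nonneg (μ := ρ₁) (s := symmDiff K E)
    have g3 := measureReal_nonneg (μ := ρ₂) (s := symmDiff K E)
    exact ⟨K, hK, hKm, by linarith, by linarith, by linarith⟩
  obtain ⟨K₁, hK₁, hKm₁, hμ₁, hρK₁, -⟩ := happrox hE₁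
  obtain ⟨K₂, hK₂, hKm₂, hμ₂, -, hρK₂⟩ := happrox hE₂
  obtain ⟨N, m, hread⟩ := exists_forall_readable (ι := Bool) (K := fun b => cond b K₁ K₂)
    (by rintro (_ | _); exacts [hK₂, hK₁])
  have hword : ∀ b : Bool, T^[N] ⁻¹' (cond b K₁ K₂) = itinerary T α (m + 1) ⁻¹'
      (itinerary T α (m + 1) '' (T^[N] ⁻¹' (cond b K₁ K₂))) := by
    intro b
    refine (subset_preimage_image _ _).antisymm ?_
    rintro x ⟨y, hy, hyx⟩
    exact (hread b y x (itinerary_eq_iff.2 fun i hi =>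
      itinerary_eq_iff.1 hyx i (by omega))).1 hy
  have hlow : ∀ {ρ : Measure Ω} [IsProbabilityMeasure ρ] {K E : Set Ω},
      MeasurePreserving T ρ ρ → MeasurableSet K → ρ.real (symmDiff K E) < ε → 2 * a ≤ ρ.real E →
      a ≤ ρ.real (T^[N] ⁻¹' K) := by
    intro ρ _ K E hρ hKm hlt hE
    rw [(hρ.iterate N).measureReal_preimage hKm.nullMeasurableSet]
    have hsub : E ⊆ K ∪ symmDiff K E := fun x hx => by
      by_cases hxK : x ∈ K
      · exact Or.inl hxK
      · exact Or.inr (Or.inr ⟨hx, hxK⟩)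
    have := (measureReal_mono (μ := ρ) hsub).trans (measureReal_union_le _ _)
    linarith [min_le_left a (κ / 4)]
  have hcard₁ := Hδ ρ₁ (m + 1) (hent₁ _ (by omega)) _ (image_subset_range _ _)
    (by rw [← hword true]; exact hlow hρ₁ hKm₁ hρK₁ ha₁)
  have hcard₂ := Hδ ρ₂ (m + 1) (hent₂ _ (by omega)) _ (image_subset_range _ _)
    (by rw [← hword false]; exact hlow hρ₂ hKm₂ hρK₂ ha₂)
  obtain ⟨k, hk⟩ := Hκ (m + 1) (by omega) _ _ (image_subset_range _ _) (image_subset_range _ _)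
    hcard₁ hcard₂
  refine ⟨k, ?_⟩
  rw [← hword true, ← hword false, cond_true, cond_false] at hk
  have hcomm : T^[N] ⁻¹' K₁ ∩ T^[k] ⁻¹' (T^[N] ⁻¹' K₂) = T^[N] ⁻¹' (K₁ ∩ T^[k] ⁻¹' K₂) := by
    rw [preimage_inter, ← preimage_comp, ← preimage_comp, ← Function.iterate_add,
      ← Function.iterate_add, add_comm]
  rw [hcomm, (hinv.iterate N).measureReal_preimage
    (hKm₁.inter ((hT.measurable.iterate k) hKm₂)).nullMeasurableSet] at hk
  have hsub : K₁ ∩ T^[k] ⁻¹' K₂ ⊆ (E₁ ∩ T^[k] ⁻¹' E₂) ∪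
      (symmDiff K₁ E₁ ∪ T^[k] ⁻¹' symmDiff K₂ E₂) := by
    rintro x ⟨hx₁, hx₂⟩
    by_cases g₁ : x ∈ E₁
    · by_cases g₂ : T^[k] x ∈ E₂
      · exact Or.inl ⟨g₁, g₂⟩
      · exact Or.inr (Or.inr (Or.inl ⟨hx₂, g₂⟩))
    · exact Or.inr (Or.inl (Or.inl ⟨hx₁, g₁⟩))
  have hb := (measureReal_mono (μ := (μ : Measure Ω)) hsub).trans
    ((measureReal_union_le _ _).trans (add_le_add_right (measureReal_union_le _ _) _))
  rw [(hinv.iterate k).measureReal_preimage (hKm₂.symmDiff hE₂).nullMeasurableSet] at hb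
  linarith [min_le_right a (κ / 4)]

/-- A limit of the measures on periodic points is the only measure of maximal entropy. -/
theorem isMME_iff_eq_of_tendsto [l.NeBot] (c : CodedSystem A T α) (hh : IsGrowthRate T α h)
    (hpos : 0 < h) (hT : Continuous T) (hα : Continuous α)
    (hgen : mΩ = MeasurableSpace.generateFrom (readableSets T α))
    (hν : ∀ n, 1 ≤ n → (ν n : Measure Ω) = perMeasure T n) (hl : l ≤ atTop)
    (hμ : Tendsto ν l (𝓝 μ)) (ρ : ProbabilityMeasure Ω) : IsMME T ρ ↔ ρ = μ := by
  have hinv := c.measurePreserving_of_tendsto hT hν hl hμ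
  have hlow := c.le_measureEntropy_of_tendsto hh hpos hT hα hν hl hμ
  have hMME : IsMME T μ := ⟨hinv, fun ρ hρ =>
    (measureEntropy_le_of_isGrowthRate hh hgen hα.measurable hρ).trans hlow⟩
  refine ⟨fun hρ => ?_, fun hρ => hρ ▸ hMME⟩
  have hent : ∀ ρ : ProbabilityMeasure Ω, IsMME T ρ → ∀ n : ℕ, 1 ≤ n →
      n * h ≤ labelEntropy (ρ : Measure Ω) (itinerary T α n) := by
    intro ρ hρ n hn
    -- Maximal entropy is at least `h`, and entropy is at most `H_n / n` for every `n`, so the bound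
    -- holds at each length and not only asymptotically.
    have h1 := (hlow.trans (hρ.2 μ hinv)).trans
      (measureEntropy_le_of_generating hgen hα.measurable hρ.1 (by omega : n ≠ 0))
    rw [EReal.coe_le_coe_iff, le_div_iff₀ (by exact_mod_cast hn)] at h1
    linarith
  have hkey := fun {ρ₁ ρ₂ : ProbabilityMeasure Ω} (h₁ : IsMME T ρ₁) (h₂ : IsMME T ρ₂)
    {E₁ E₂ : Set Ω} (hE₁ : MeasurableSet E₁) (hE₂ : MeasurableSet E₂) =>
    c.exists_measureReal_inter_pos hh hpos hT hα hgen hν hl hμ h₁.1 h₂.1 (hent ρ₁ h₁)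
      (hent ρ₂ h₂) hE₁ hE₂
  have herg : Ergodic T (μ : Measure Ω) := by
    refine ⟨hinv, ⟨fun s hs hTs => ?_⟩⟩
    by_contra hcon
    have hs0 : (μ : Measure Ω) s ≠ 0 ∧ (μ : Measure Ω) sᶜ ≠ 0 := by
      simpa [eventuallyConst_set, ae_iff, and_comm] using! hcon
    -- For an invariant set, `s ∩ T^{-k} sᶜ` is empty for every `k`.
    obtain ⟨k, hk⟩ := hkey hMME hMME hs hs.compl
      (ENNReal.toReal_pos hs0.1 (measure_ne_top _ _))
      (ENNReal.toReal_pos hs0.2 (measure_ne_top _ _))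
    have hiter : T^[k] ⁻¹' s = s := by
      rw [preimage_iterate_eq]
      exact Function.iterate_fixed hTs k
    rw [preimage_compl, hiter, inter_compl_self, measureReal_empty] at hk
    exact hk.false
  have hac : (ρ : Measure Ω) ≪ μ := by
    refine Measure.AbsolutelyContinuous.mk fun s hs hs0 => ?_
    by_contra hcon
    obtain ⟨k, hk⟩ := hkey hρ hMME hs MeasurableSet.univ
      (ENNReal.toReal_pos hcon (measure_ne_top _ _)) (by simp)
    rw [preimage_univ, inter_univ, Measure.real, hs0] at hk
    exact hk.false
  exact ProbabilityMeasure.toMeasure_injective (herg.eq_of_absolutelyContinuous hρ.1 hac)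

end Limit

/-- Intrinsic ergodicity and equidistribution of periodic points for coded systems. -/
theorem intrinsicallyErgodic [CompactSpace Ω] [T2Space Ω] [HasOuterApproxClosed Ω]
    (c : CodedSystem A T α) (hT : Continuous T) (hα : Continuous α)
    (hgen : mΩ = MeasurableSpace.generateFrom (readableSets T α)) (hfix : ∃ x, T x = x)
    (hconst : (∀ x y, α x = α y) → Subsingleton Ω) :
    IntrinsicallyErgodic T ∧ ∀ μ : ProbabilityMeasure Ω, IsMME T μ → PerMeasuresConverge T μ := by
  obtain ⟨x₀, hx₀⟩ := hfix
  have hper : ∀ n : ℕ, 1 ≤ n → (Per T n).Finite ∧ (Per T n).Nonempty := fun n hn =>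
    ⟨c.finite_per n, x₀, 1, le_rfl, hn, hx₀⟩
  have hprob : ∀ n : ℕ, 1 ≤ n → IsProbabilityMeasure (perMeasure T n) := fun n hn =>
    isProbabilityMeasure_perMeasure (hper n hn).1 (hper n hn).2
  have hex : ∀ n : ℕ, ∃ ρ : ProbabilityMeasure Ω, 1 ≤ n → (ρ : Measure Ω) = perMeasure T n := by
    intro n
    rcases Nat.eq_zero_or_pos n with rfl | hn
    -- `Per T 0` is empty, so the measure at index `0` is an arbitrary default.
    · exact ⟨⟨perMeasure T 1, hprob 1 le_rfl⟩, fun h => absurd h (by omega)⟩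
    · exact ⟨⟨perMeasure T n, hprob n hn⟩, fun _ => rfl⟩
  choose ν hν using hex
  have := c.nonempty
  obtain ⟨h, hh⟩ := exists_isGrowthRate (T := T) (α := α)
  rcases hh.nonneg.eq_or_lt with rfl | hpos
  · have hsub := hconst fun x y => by
      rw [c.label_eq_of_growthRate_zero hh x, c.label_eq_of_growthRate_zero hh y]
    have hpm : ∀ μ μ' : ProbabilityMeasure Ω, μ = μ' := fun μ μ' => by
      refine ProbabilityMeasure.eq_of_forall_toMeasure_apply_eq _ _ fun s _ => ?_
      rcases s.eq_empty_or_nonempty with rfl | hs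
      · simp
      · rw [Subsingleton.eq_univ_of_nonempty hs, measure_univ, measure_univ]
    refine ⟨⟨ν 1, ⟨?_, fun μ _ => by rw [hpm μ (ν 1)]⟩, fun μ _ => hpm _ _⟩,
      fun μ _ => ⟨hper, ν, hν, ?_⟩⟩
    · rw [show T = id from funext fun x => Subsingleton.elim _ _]
      exact MeasurePreserving.id _
    · rw [show ν = fun _ => μ from funext fun n => hpm _ _]
      exact tendsto_const_nhds
  · obtain ⟨μ₀, hμ₀⟩ : ∃ μ, Tendsto ν (Ultrafilter.of atTop : Ultrafilter ℕ) (𝓝 μ) := by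
      obtain ⟨μ, -, hμ⟩ := isCompact_univ.ultrafilter_le_nhds
        ((Ultrafilter.of (atTop : Filter ℕ)).map ν) (by simp)
      exact ⟨μ, hμ⟩
    have huniq := c.isMME_iff_eq_of_tendsto hh hpos hT hα hgen hν (Ultrafilter.of_le atTop) hμ₀
    refine ⟨⟨μ₀, (huniq μ₀).2 rfl, fun ρ hρ => (huniq ρ).1 hρ⟩, fun μ hμ => ⟨hper, ν, hν, ?_⟩⟩
    -- Along each ultrafilter a limit exists by compactness, and every such limit is the unique
    -- measure of maximal entropy.
    refine (tendsto_iff_ultrafilter _ _ _).2 fun g hg => ?_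
    obtain ⟨μ', -, hμ'⟩ := isCompact_univ.ultrafilter_le_nhds (g.map ν) (by simp)
    have := (c.isMME_iff_eq_of_tendsto hh hpos hT hα hgen hν hg hμ' μ).1 hμ
    rw [this]
    exact hμ'

end CodedSystem

/-! ### Factors of coded shifts -/

section Factors

/-- The word formed by the first `n` letters of `x`. -/
def prefixWord {A : Type*} (x : ℕ → A) (n : ℕ) : List A := (List.range n).map x

theorem length_prefixWord {A : Type*} (x : ℕ → A) (n : ℕ) : (prefixWord x n).length = n := by
  simp [prefixWord]

theorem take_drop_prefixWord {A : Type*} (x : ℕ → A) {n j l : ℕ} (h : j + l ≤ n) :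
    ((prefixWord x n).drop j).take l = prefixWord (fun i => x (j + i)) l := by
  refine List.ext_getElem (by simp [prefixWord]; omega) fun i h1 h2 => ?_
  simp [prefixWord]

theorem take_drop_eq_prefixWord_getD {A : Type*} (v : List A) (a : A) {j l : ℕ}
    (h : j + l ≤ v.length) :
    (v.drop j).take l = prefixWord (fun i => v.getD ((j + i) % v.length) a) l := by
  refine List.ext_getElem (by simp [prefixWord]; omega) fun i h1 h2 => ?_
  have hi : i < l := by simpa [prefixWord] using h2
  simp only [prefixWord, List.getElem_take, List.getElem_drop, List.getElem_map,
    List.getElem_range]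
  rw [Nat.mod_eq_of_lt (by omega), List.getD_eq_getElem _ _ (by omega)]

/-- The words of the one-sided shift `X` have the form `0^i v (s k)`, where `v` ranges over a set
`G` of words that can be concatenated freely and repeated periodically. -/
structure CodedShift {A : Type*} [TopologicalSpace A] (X : Subshift A ℕ) where
  zero : A
  G : Set (List A)
  s : ℕ → List A
  nil_mem : [] ∈ G
  append_mem : ∀ {u v}, u ∈ G → v ∈ G → u ++ v ∈ G
  length_s : ∀ k, (s k).length = k
  exists_left : ∀ i, ∃ p, p ++ List.replicate i zero ∈ G
  exists_right : ∀ k, ∃ q, s k ++ q ∈ G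
  const_mem : (fun _ => zero) ∈ X.carrier
  decomp : ∀ x ∈ X.carrier, ∀ n, ∃ i v k, v ∈ G ∧
    prefixWord x n = List.replicate i zero ++ v ++ s k
  periodic_mem : ∀ v ∈ G, v ≠ [] → (fun n => v.getD (n % v.length) zero) ∈ X.carrier

theorem shiftMap_iterate_apply {A J : Type*} [TopologicalSpace A] [AddMonoidWithOne J]
    (X : Subshift A J) (k : ℕ) (x : X.carrier) (g : J) :
    ((shiftMap X)^[k] x : J → A) g = (x : J → A) (k + g) := by
  induction k generalizing g with
  | zero => simp
  | succ k ih =>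
    rw [Function.iterate_succ_apply', Nat.cast_succ, add_assoc]
    exact ih (1 + g)

theorem continuous_shiftMap {A J : Type*} [TopologicalSpace A] [AddMonoidWithOne J]
    (X : Subshift A J) : Continuous (shiftMap X) :=
  (continuous_shift 1).restrict (X.mapsTo 1)

/-- A continuous map from a subshift to a discrete space depends on finitely many coordinates. -/
theorem exists_finset_of_continuous {A B J : Type*} [TopologicalSpace A] [DiscreteTopology A]
    [Finite A] [TopologicalSpace B] [DiscreteTopology B] {K : Set (J → A)} (hK : IsClosed K)
    {f : K → B} (hf : Continuous f) :
    ∃ I : Finset J, ∀ x y : K, (∀ i ∈ I, (x : J → A) i = (y : J → A) i) → f x = f y := by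
  classical
  have hloc : ∀ x : K, ∃ I : Finset J, ∀ y : K, (∀ i ∈ I, (y : J → A) i = (x : J → A) i) →
      f y = f x := by
    intro x
    obtain ⟨V, hV, hVf⟩ := isOpen_induced_iff.1 ((isOpen_discrete {f x}).preimage hf)
    have hxV : (x : J → A) ∈ V := by
      have : x ∈ Subtype.val ⁻¹' V := by rw [hVf]; rfl
      exact this
    obtain ⟨I, u, hu, hsub⟩ := isOpen_pi_iff.1 hV x hxV
    refine ⟨I, fun y hy => ?_⟩
    have : y ∈ f ⁻¹' {f x} := by
      rw [← hVf]
      exact hsub fun i hi => by rw [hy i hi]; exact (hu i hi).2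
    exact this
  choose I hI using hloc
  obtain ⟨t, ht⟩ := hK.isCompact.elim_finite_subcover
    (fun x : K => {y : J → A | ∀ i ∈ I x, y i = (x : J → A) i})
    (fun x => by
      have : {y : J → A | ∀ i ∈ I x, y i = (x : J → A) i} =
          (I x : Set J).pi fun i => {(x : J → A) i} := by ext y; simp [Set.pi]
      rw [this]
      exact isOpen_set_pi (Finset.finite_toSet _) fun i _ => isOpen_discrete _)
    (fun x hx => mem_iUnion.2 ⟨⟨x, hx⟩, fun _ _ => rfl⟩)
  refine ⟨t.biUnion I, fun x y hxy => ?_⟩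
  obtain ⟨z, hz, hxz⟩ : ∃ z ∈ t, ∀ i ∈ I z, (x : J → A) i = (z : J → A) i := by
    simpa only [mem_iUnion, exists_prop, mem_ofPred_eq] using ht x.2
  rw [hI z x hxz, hI z y fun i hi => ?_]
  rw [← hxz i hi, hxy i (Finset.mem_biUnion.2 ⟨z, hz, hi⟩)]

variable {A J : Type*} [TopologicalSpace A] [AddMonoidWithOne J] {p : ℕ}

/-- The map reading off the coordinate at `0`. -/
def coordZero (Y : Subshift (Fin p) J) (y : Y.carrier) : Fin p := (y : J → Fin p) 0

theorem continuous_coordZero (Y : Subshift (Fin p) J) : Continuous (coordZero Y) :=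
  (continuous_apply 0).comp continuous_subtype_val

theorem coordZero_iterate (Y : Subshift (Fin p) J) (k : ℕ) (y : Y.carrier) :
    coordZero Y ((shiftMap Y)^[k] y) = (y : J → Fin p) k := by
  rw [coordZero, shiftMap_iterate_apply, add_zero]

/-- Every index can be moved into the nonnegative integers by adding a multiple of `k`. -/
def IsTranslatable (J : Type*) [AddMonoidWithOne J] : Prop :=
  ∀ (g : J) (k : ℕ), 1 ≤ k → ∃ M n : ℕ, ((k * M : ℕ) : J) + g = n

theorem isTranslatable_nat : IsTranslatable ℕ := fun g _ _ => ⟨0, g, by simp⟩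

theorem isTranslatable_int : IsTranslatable ℤ := fun g k hk => by
  refine ⟨g.natAbs, ((k * g.natAbs : ℕ) + g).toNat, ?_⟩
  have h1 : g.natAbs ≤ k * g.natAbs := Nat.le_mul_of_pos_left _ hk
  rw [Int.toNat_of_nonneg (by omega)]

/-- Coordinate `g` of the point shifted `M` times is coordinate `M + g = n ≥ 0` of the original one,
hence one of its first `n + 1` labels. -/
theorem generateFrom_readableSets_coordZero (hJ : IsTranslatable J) (Y : Subshift (Fin p) J) :
    (inferInstance : MeasurableSpace Y.carrier) =
      MeasurableSpace.generateFrom (readableSets (shiftMap Y) (coordZero Y)) := by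
  refine le_antisymm ?_ (MeasurableSpace.generateFrom_le fun K hK => hK.1)
  refine measurable_iff_comap_le.1 (@measurable_pi_lambda _ _ _
    (MeasurableSpace.generateFrom (readableSets (shiftMap Y) (coordZero Y))) _ _ fun g => ?_)
  refine @measurable_to_countable' _ _ _ _
    (MeasurableSpace.generateFrom (readableSets (shiftMap Y) (coordZero Y))) _ fun a => ?_
  refine MeasurableSpace.measurableSet_generateFrom
    ⟨((measurable_pi_apply g).comp measurable_subtype_coe) (measurableSet_singleton a), ?_⟩
  obtain ⟨M, n, hMn⟩ := hJ g 1 le_rfl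
  rw [one_mul] at hMn
  refine ⟨M, n + 1, fun x y hxy => ?_⟩
  have := itinerary_eq_iff.1 hxy n (Nat.lt_succ_self n)
  rw [coordZero_iterate, coordZero_iterate] at this
  simp only [mem_preimage, mem_singleton_iff, shiftMap_iterate_apply, hMn, this]

/-- By periodicity coordinate `g` equals coordinate `k M + g = n ≥ 0`, and then coordinate `n % k`,
which is among the first `k` labels. -/
theorem eq_of_isPeriodicPt_shiftMap (hJ : IsTranslatable J) (Y : Subshift (Fin p) J)
    (x y : Y.carrier) (k : ℕ) (hk : 1 ≤ k) (hx : (shiftMap Y)^[k] x = x)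
    (hy : (shiftMap Y)^[k] y = y)
    (hxy : itinerary (shiftMap Y) (coordZero Y) k x = itinerary (shiftMap Y) (coordZero Y) k y) :
    x = y := by
  have hx' : Function.IsPeriodicPt (shiftMap Y) k x := hx
  have hy' : Function.IsPeriodicPt (shiftMap Y) k y := hy
  refine Subtype.ext (funext fun g => ?_)
  obtain ⟨M, n, hMn⟩ := hJ g k hk
  have key : ∀ z : Y.carrier, Function.IsPeriodicPt (shiftMap Y) k z →
      (z : J → Fin p) g = coordZero Y ((shiftMap Y)^[n % k] z) := by
    intro z hz
    rw [hz.iterate_mod_apply, coordZero_iterate, ← hMn, ← shiftMap_iterate_apply,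
      (hz.mul_const M).eq]
  rw [key x hx', key y hy']
  exact itinerary_eq_iff.1 hxy _ (Nat.mod_lt _ hk)

/-- Factors of `Z` are intrinsically ergodic, if the right tails of the points of `Z` belong to a
coded shift `X` whose periodic points extend to periodic points of `Z`. -/
theorem intrinsicallyErgodic_of_isFactor [DiscreteTopology A] [Finite A] [Countable J]
    (hJ : IsTranslatable J) {X : Subshift A ℕ} (c : CodedShift X) {Z : Subshift A J}
    (htail : ∀ z ∈ Z.carrier, (fun n : ℕ => z n) ∈ X.carrier)
    (hconst : (fun _ => c.zero) ∈ Z.carrier)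
    (hper : ∀ v ∈ c.G, v ≠ [] → ∃ z : Z.carrier, (shiftMap Z)^[v.length] z = z ∧
      ∀ n : ℕ, (z : J → A) n = v.getD (n % v.length) c.zero)
    {Y : Subshift (Fin p) J}
    (hwin : ∀ I : Finset J, ∃ N r : ℕ, Function.Surjective (shiftMap Y)^[N] ∧
      ∀ i ∈ I, ∃ l : ℕ, l ≤ r ∧ (N : J) + i = l)
    (hfac : IsFactor Z Y) :
    IntrinsicallyErgodic (shiftMap Y) ∧ ∀ μ : ProbabilityMeasure Y.carrier,
      IsMME (shiftMap Y) μ → PerMeasuresConverge (shiftMap Y) μ := by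
  obtain ⟨π, hπc, hπs, hπ⟩ := hfac
  have hπ' : ∀ k z, π ((shiftMap Z)^[k] z) = (shiftMap Y)^[k] (π z) := fun k =>
    (show Function.Semiconj π (shiftMap Z) (shiftMap Y) from hπ).iterate_right k
  -- The zeroth letter of the image depends on a finite window `I`; `N` shifts move this window into
  -- `[0, r]`. Surjectivity of `N` shifts on `Y` lets every point of `Y` be described this way.
  obtain ⟨I, hI⟩ := exists_finset_of_continuous Z.isClosed
    ((continuous_coordZero Y).comp hπc)
  obtain ⟨N, r, hsurj, hIr⟩ := hwin I
  have hNonempty : Nonempty Z.carrier := ⟨⟨_, hconst⟩⟩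
  have hdep : ∀ z z' : Z.carrier, (∀ i ≤ r, (z : J → A) i = (z' : J → A) i) →
      coordZero Y ((shiftMap Y)^[N] (π z)) = coordZero Y ((shiftMap Y)^[N] (π z')) := by
    intro z z' h
    rw [← hπ', ← hπ']
    refine hI _ _ fun i hi => ?_
    obtain ⟨l, hl, hNl⟩ := hIr i hi
    rw [shiftMap_iterate_apply, shiftMap_iterate_apply, hNl, h l hl]
  obtain ⟨F, hF⟩ : ∃ F : List A → Fin p, ∀ z : Z.carrier,
      F (prefixWord (fun n : ℕ => (z : J → A) n) (r + 1)) =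
        coordZero Y ((shiftMap Y)^[N] (π z)) := by
    obtain ⟨z₀⟩ := hNonempty
    have hfact : Function.FactorsThrough
        (fun z : Z.carrier => coordZero Y ((shiftMap Y)^[N] (π z)))
        (fun z : Z.carrier => prefixWord (fun n : ℕ => (z : J → A) n) (r + 1)) := by
      intro z z' h
      refine hdep z z' fun i hi => ?_
      exact List.map_inj_left.1 h i (List.mem_range.2 (by omega))
    exact ⟨Function.extend _ _ fun _ => coordZero Y (π z₀), hfact.extend_apply _⟩
  have hlabel : ∀ (z : Z.carrier) (j : ℕ),
      coordZero Y ((shiftMap Y)^[j] ((shiftMap Y)^[N] (π z))) =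
        F (prefixWord (fun n : ℕ => (z : J → A) (j + n : ℕ)) (r + 1)) := by
    intro z j
    have h1 := hF ((shiftMap Z)^[j] z)
    rw [hπ', ← Function.iterate_add_apply, add_comm N j, Function.iterate_add_apply] at h1
    rw [← h1]
    simp only [shiftMap_iterate_apply, Nat.cast_add]
  let cs : CodedSystem A (shiftMap Y) (coordZero Y) :=
    { r := r
      zero := c.zero
      F := F
      G := c.G
      s := c.s
      nil_mem := c.nil_mem
      append_mem := c.append_mem
      length_s := c.length_s
      exists_left := c.exists_left
      exists_right := c.exists_right
      cover := by
        intro y n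
        obtain ⟨y', rfl⟩ := hsurj y
        obtain ⟨z, rfl⟩ := hπs y'
        obtain ⟨i, v, k, hv, hw⟩ := c.decomp _ (htail z z.2) (n + r)
        refine ⟨i, v, k, hv, ?_, ?_⟩
        · have := congrArg List.length hw
          simp only [length_prefixWord, List.length_append, List.length_replicate,
            c.length_s] at this
          exact this.symm
        · funext j
          have hj := j.2
          rw [itinerary, hlabel, blockCode, ← hw, take_drop_prefixWord _ (by omega)]
      realize := by
        intro v hv hne
        obtain ⟨z, hz, hzv⟩ := hper v hv hne
        refine ⟨(shiftMap Y)^[N] (π z), ?_, fun j hj => ?_⟩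
        · rw [← Function.iterate_add_apply, add_comm, Function.iterate_add_apply, ← hπ', hz]
        · rw [hlabel, take_drop_eq_prefixWord_getD v c.zero (by omega)]
          simp only [hzv]
      eq_of_periodic := eq_of_isPeriodicPt_shiftMap hJ Y }
  have : CompactSpace Y.carrier := isCompact_iff_compactSpace.1 Y.isClosed.isCompact
  have : TopologicalSpace.MetrizableSpace Y.carrier :=
    TopologicalSpace.metrizableSpace_of_t3_secondCountable _
  let _ := TopologicalSpace.metrizableSpaceMetric Y.carrier
  refine cs.intrinsicallyErgodic (continuous_shiftMap Y) (continuous_coordZero Y)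
    (generateFrom_readableSets_coordZero hJ Y) ⟨π ⟨_, hconst⟩, ?_⟩ fun h => ?_
  · rw [← hπ]
    rfl
  -- Shifting by `g` brings any coordinate to `0`, so constant labels leave a single point.
  · refine ⟨fun x y => Subtype.ext (funext fun g => ?_)⟩
    have := h ⟨shift g (x : J → Fin p), Y.mapsTo g x.2⟩ ⟨shift g (y : J → Fin p), Y.mapsTo g y.2⟩
    simpa [coordZero] using this

end Factors

/-! ### One-sided and two-sided coded shifts -/

section CodedShifts

namespace CodedShift

variable {A : Type*} [TopologicalSpace A] [DiscreteTopology A] [Finite A] {X : Subshift A ℕ}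
  {p : ℕ}

theorem intrinsicallyErgodic_factor (c : CodedShift X) {Y : Subshift (Fin p) ℕ}
    (hfac : IsFactor X Y) :
    IntrinsicallyErgodic (shiftMap Y) ∧ ∀ μ : ProbabilityMeasure Y.carrier,
      IsMME (shiftMap Y) μ → PerMeasuresConverge (shiftMap Y) μ := by
  refine intrinsicallyErgodic_of_isFactor isTranslatable_nat c (fun z hz => by simpa using hz)
    c.const_mem (fun v hv hne => ?_) (fun I => ?_) hfac
  · refine ⟨⟨_, c.periodic_mem v hv hne⟩, Subtype.ext (funext fun n => ?_), fun n => by simp⟩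
    rw [shiftMap_iterate_apply]
    simp
  · exact ⟨0, I.sup id, Function.surjective_id,
      fun i hi => ⟨i, Finset.le_sup (f := id) hi, by simp⟩⟩

theorem intrinsicallyErgodic_twoSided_factor (c : CodedShift X) {Y : Subshift (Fin p) ℤ}
    (hfac : IsFactor (twoSided X) Y) :
    IntrinsicallyErgodic (shiftMap Y) ∧ ∀ μ : ProbabilityMeasure Y.carrier,
      IsMME (shiftMap Y) μ → PerMeasuresConverge (shiftMap Y) μ := by
  refine intrinsicallyErgodic_of_isFactor isTranslatable_int c (Z := twoSided X)
    (fun z hz => by simpa using hz 0) (fun _ => c.const_mem) (fun v hv hne => ?_) (fun I => ?_) hfac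
  · have hl : 0 < v.length := List.length_pos_iff.2 hne
    have hl' : (0 : ℤ) < v.length := by exact_mod_cast hl
    refine ⟨⟨fun i => v.getD (i % v.length).toNat c.zero, fun i => ?_⟩,
      Subtype.ext (funext fun g => ?_), fun n => ?_⟩
    · have hmem := X.mapsTo (i % v.length).toNat (c.periodic_mem v hv hne)
      convert hmem using 1
      funext n
      rw [shift_apply]
      have h1 := Int.emod_nonneg i hl'.ne'
      have h2 : ((i + n) % v.length).toNat = ((i % v.length).toNat + n) % v.length := by
        zify
        rw [Int.toNat_of_nonneg h1, Int.toNat_of_nonneg (Int.emod_nonneg _ hl'.ne'),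
          Int.emod_add_emod]
      simp only [h2]
    · rw [shiftMap_iterate_apply]
      simp
    · norm_cast
  -- A window inside `[-M, M]` moves into `[0, 2 M]` after `M` shifts, and the two-sided shift is
  -- invertible.
  · refine ⟨I.sup Int.natAbs, 2 * I.sup Int.natAbs, ?_, fun i hi => ?_⟩
    · refine Function.Surjective.iterate (fun y => ?_) _
      refine ⟨⟨shift (-1) (y : ℤ → Fin p), Y.mapsTo (-1) y.2⟩, Subtype.ext (funext fun g => ?_)⟩
      change (y : ℤ → Fin p) (-1 + (1 + g)) = _
      rw [neg_add_cancel_left]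
    · have : i.natAbs ≤ I.sup Int.natAbs := Finset.le_sup (f := Int.natAbs) hi
      exact ⟨((I.sup Int.natAbs : ℕ) + i).toNat, by omega, by omega⟩

end CodedShift

theorem getD_flatten_replicate {A : Type*} (v : List A) (a : A) {n i : ℕ}
    (h : i < n * v.length) :
    (List.replicate n v).flatten.getD i a = v.getD (i % v.length) a := by
  induction n generalizing i with
  | zero => simp at h
  | succ n ih =>
    rw [List.replicate_succ, List.flatten_cons]
    rcases lt_or_ge i v.length with hi | hi
    · rw [List.getD_append _ _ _ _ hi, Nat.mod_eq_of_lt hi]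
    · rw [List.getD_append_right _ _ _ _ hi, ih (by rw [add_mul] at h; omega),
        Nat.mod_eq_sub_mod hi]

theorem mem_closure_iff_forall_agree {A : Type*} [TopologicalSpace A] [DiscreteTopology A]
    {K : Set (ℕ → A)} {x : ℕ → A} :
    x ∈ closure K ↔ ∀ n, ∃ y ∈ K, ∀ i < n, y i = x i := by
  refine ⟨fun hx n => ?_, fun h => mem_closure_iff.2 fun V hV hxV => ?_⟩
  · have hopen : IsOpen ((Finset.range n : Set ℕ).pi fun i => {x i}) :=
      isOpen_set_pi (Finset.finite_toSet _) fun i _ => isOpen_discrete _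
    obtain ⟨y, hy, hyK⟩ := mem_closure_iff.1 hx _ hopen fun i _ => rfl
    exact ⟨y, hyK, fun i hi => hy i (by simpa using hi)⟩
  · obtain ⟨I, u, hu, hsub⟩ := isOpen_pi_iff.1 hV x hxV
    obtain ⟨y, hy, hyx⟩ := h (I.sup id + 1)
    refine ⟨y, hsub fun i hi => ?_, hy⟩
    rw [hyx i (Nat.lt_succ_of_le (Finset.le_sup (f := id) hi))]
    exact (hu i hi).2

end CodedShifts

/-! ### β-shifts -/

section Beta

/-- The word `l` maps the points of `[0, c)` whose `β`-expansion starts with `l` onto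
`[0, betaState β c l)`. -/
noncomputable def betaState (β : ℝ) {m : ℕ} (c : ℝ) (l : List (Fin m)) : ℝ :=
  l.foldl (fun (c : ℝ) (d : Fin m) => min 1 (β * c - (d : ℕ))) c

/-- The quasi-greedy `β`-expansion of `1`, as a sequence of words. -/
noncomputable def quasiGreedy (β : ℝ) : ℕ → List (Fin (⌈β⌉₊ + 1))
  | 0 => []
  | k + 1 => quasiGreedy β k ++
      [Fin.ofNat _ (⌈β * betaState β 1 (quasiGreedy β k)⌉₊ - 1)]

variable {β : ℝ}

theorem betaState_append {m : ℕ} (c : ℝ) (u v : List (Fin m)) :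
    betaState β c (u ++ v) = betaState β (betaState β c u) v := List.foldl_append

theorem betaState_cons {m : ℕ} (c : ℝ) (d : Fin m) (v : List (Fin m)) :
    betaState β c (d :: v) = betaState β (min 1 (β * c - (d : ℕ))) v := rfl

theorem betaState_nil {m : ℕ} (c : ℝ) : betaState β c ([] : List (Fin m)) = c := rfl

theorem betaState_le_one {m : ℕ} {c : ℝ} (hc : c ≤ 1) (l : List (Fin m)) :
    betaState β c l ≤ 1 := by
  induction l generalizing c with
  | nil => exact hc
  | cons d l ih => exact ih (min_le_left _ _)

/-- Each `0` multiplies the state by `β` until it is capped at `1`. Thus enough zeros bring any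
positive state back to `1`. -/
theorem le_betaState_replicate_zero (hβ : 1 < β) {m : ℕ} (c : ℝ) (n : ℕ) :
    min 1 (β ^ n * c) ≤ betaState β c (List.replicate n (0 : Fin (m + 1))) := by
  induction n generalizing c with
  | zero => simp [betaState_nil]
  | succ n ih =>
    rw [List.replicate_succ, betaState_cons]
    refine le_trans ?_ (ih _)
    refine le_min (min_le_left _ _) ?_
    have h1 : 1 ≤ β ^ n := one_le_pow₀ hβ.le
    rw [mul_min_of_nonneg _ _ (by positivity), mul_one]
    refine le_min ((min_le_left _ _).trans h1) ((min_le_right _ _).trans (le_of_eq ?_))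
    simp [pow_succ, mul_assoc]

theorem ceil_sub_one_lt (hβ : 1 < β) {c : ℝ} (hc : c ≤ 1) : ⌈β * c⌉₊ - 1 < ⌈β⌉₊ + 1 := by
  have : ⌈β * c⌉₊ ≤ ⌈β⌉₊ := Nat.ceil_mono (by nlinarith)
  omega

/-- `⌈β c⌉ - 1` is the largest integer strictly below `β c`, so the state never reaches `0`. -/
theorem betaState_quasiGreedy (hβ : 1 < β) (k : ℕ) :
    0 < betaState β 1 (quasiGreedy β k) ∧ betaState β 1 (quasiGreedy β k) ≤ 1 := by
  refine ⟨?_, betaState_le_one le_rfl _⟩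
  induction k with
  | zero => simp [quasiGreedy, betaState_nil]
  | succ k ih =>
    have hle := betaState_le_one (β := β) le_rfl (quasiGreedy β k)
    rw [quasiGreedy, betaState_append, betaState_cons, betaState_nil]
    set c := betaState β 1 (quasiGreedy β k)
    have hpos : 0 < β * c := by positivity
    have h1 : 1 ≤ ⌈β * c⌉₊ := Nat.one_le_ceil_iff.2 hpos
    have h2 := Nat.ceil_lt_add_one hpos.le
    refine lt_min one_pos ?_
    rw [Fin.val_ofNat, Nat.mod_eq_of_lt (ceil_sub_one_lt hβ hle), Nat.cast_sub h1]
    push_cast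
    linarith

/-- Cut `l` after its last prefix of state `1`. From then on the states lie strictly between `0` and
`1`, so each digit `d` satisfies `0 < β c - d < 1`, that is, `d = ⌈β c⌉ - 1`: the quasi-greedy
digit. -/
theorem exists_eq_append_quasiGreedy (hβ : 1 < β) (l : List (Fin (⌈β⌉₊ + 1)))
    (hl : 0 < betaState β 1 l) :
    ∃ v k, betaState β 1 v = 1 ∧ l = v ++ quasiGreedy β k := by
  induction l using List.reverseRecOn with
  | nil => exact ⟨[], 0, rfl, rfl⟩
  | append_singleton l d ih =>
    by_cases h1 : betaState β 1 (l ++ [d]) = 1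
    · exact ⟨_, 0, h1, (List.append_nil _).symm⟩
    rw [betaState_append, betaState_cons, betaState_nil] at hl h1
    have hd : (0 : ℝ) ≤ (d : ℕ) := Nat.cast_nonneg _
    have hpos : 0 < β * betaState β 1 l - (d : ℕ) := hl.trans_le (min_le_right _ _)
    have hlt : β * betaState β 1 l - (d : ℕ) < 1 := by
      by_contra hge
      exact h1 (min_eq_left (not_lt.1 hge))
    obtain ⟨v, k, hv, rfl⟩ := ih (by
      by_contra hneg
      nlinarith)
    refine ⟨v, k + 1, hv, ?_⟩
    rw [betaState_append, hv] at hpos hlt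
    rw [quasiGreedy, List.append_assoc]
    congr 3
    have hceil : ⌈β * betaState β 1 (quasiGreedy β k)⌉₊ = d + 1 := by
      rw [Nat.ceil_eq_iff (by omega)]
      rw [Nat.add_sub_cancel]
      push_cast
      exact ⟨by linarith, by linarith⟩
    ext
    rw [hceil, Nat.add_sub_cancel, Fin.val_ofNat, Nat.mod_eq_of_lt d.2]

theorem betaMap_iterate_mem {t : ℝ} (ht : t ∈ Ico (0 : ℝ) 1) (n : ℕ) :
    (betaMap β)^[n] t ∈ Ico (0 : ℝ) 1 := by
  cases n with
  | zero => exact ht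
  | succ n =>
    rw [Function.iterate_succ_apply']
    exact ⟨Int.fract_nonneg _, Int.fract_lt_one _⟩

theorem betaMap_eq_sub_floor (hβ : 1 < β) {t : ℝ} (ht : 0 ≤ t) :
    betaMap β t = β * t - ⌊β * t⌋₊ := by
  rw [betaMap, Int.fract, ← natCast_floor_eq_intCast_floor (by positivity)]

/-- Applied to a digit sequence of a point of `[0,1)`, this makes the state of every prefix
positive, as the decomposition requires. -/
theorem betaMap_iterate_lt_betaState (hβ : 1 < β) {t : ℝ} (ht : t ∈ Ico (0 : ℝ) 1)
    {y : ℕ → Fin (⌈β⌉₊ + 1)} (hy : ∀ n : ℕ, (y n : ℕ) = ⌊β * (betaMap β)^[n] t⌋₊) (n : ℕ) :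
    (betaMap β)^[n] t < betaState β 1 (prefixWord y n) := by
  induction n with
  | zero => exact ht.2
  | succ n ih =>
    rw [prefixWord, List.range_succ, List.map_append, betaState_append, List.map_singleton,
      betaState_cons, betaState_nil]
    refine lt_min (betaMap_iterate_mem ht _).2 ?_
    rw [Function.iterate_succ_apply', betaMap_eq_sub_floor hβ (betaMap_iterate_mem ht n).1, hy n]
    have : β * (betaMap β)^[n] t < β * betaState β 1 (prefixWord y n) := by gcongr
    exact sub_lt_sub_right this _

/-- Pull `t'` back along the inverse branches `t ↦ (t + d) / β`; the definition of the state keeps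
each preimage in its interval. -/
theorem exists_betaMap_iterate_eq (hβ : 1 < β) {m : ℕ} (l : List (Fin m)) {c : ℝ} {t' : ℝ}
    (ht' : t' ∈ Ico 0 (betaState β c l)) :
    ∃ t ∈ Ico 0 c, (betaMap β)^[l.length] t = t' ∧
      ∀ j (hj : j < l.length), (l[j] : ℕ) = ⌊β * (betaMap β)^[j] t⌋₊ := by
  induction l generalizing c with
  | nil => exact ⟨t', ht', rfl, fun j hj => absurd hj (by simp)⟩
  | cons d l ih =>
    obtain ⟨t₁, ht₁, hiter, hdig⟩ := ih ht'
    have h1 : t₁ < 1 := ht₁.2.trans_le (min_le_left _ _)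
    have h2 : t₁ < β * c - (d : ℕ) := ht₁.2.trans_le (min_le_right _ _)
    have hd : (0 : ℝ) ≤ (d : ℕ) := Nat.cast_nonneg _
    have hβ0 : 0 < β := by linarith
    have ht₁0 := ht₁.1
    have hβt : β * ((t₁ + (d : ℕ)) / β) = t₁ + (d : ℕ) := by field_simp
    have hfloor : ⌊t₁ + (d : ℕ)⌋₊ = d := by
      rw [Nat.floor_add_natCast ht₁0, Nat.floor_eq_zero.2 h1, zero_add]
    have hmap : betaMap β ((t₁ + (d : ℕ)) / β) = t₁ := by
      rw [betaMap_eq_sub_floor hβ (by positivity), hβt, hfloor]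
      ring
    refine ⟨(t₁ + (d : ℕ)) / β, ⟨by positivity, ?_⟩, ?_, fun j hj => ?_⟩
    · rw [div_lt_iff₀ hβ0]; linarith
    · rw [List.length_cons, Function.iterate_succ_apply, hmap, hiter]
    · cases j with
      | zero => simp [hβt, hfloor]
      | succ j =>
        rw [Function.iterate_succ_apply, hmap]
        exact hdig j _

/-- The `β`-shift is a coded shift. -/
noncomputable def codedShiftBeta (hβ : 1 < β) : CodedShift (betaShift β) :=
  have hrep : ∀ i, betaState β 1 (List.replicate i (0 : Fin (⌈β⌉₊ + 1))) = 1 := fun i => by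
    refine (betaState_le_one le_rfl _).antisymm (le_trans ?_ (le_betaState_replicate_zero hβ 1 i))
    rw [mul_one]
    exact le_min le_rfl (one_le_pow₀ hβ.le)
  have happ : ∀ {u v : List (Fin (⌈β⌉₊ + 1))}, betaState β 1 u = 1 → betaState β 1 v = 1 →
      betaState β 1 (u ++ v) = 1 := fun hu hv => by rw [betaState_append, hu, hv]
  have hper : ∀ v : List (Fin (⌈β⌉₊ + 1)), betaState β 1 v = 1 → v ≠ [] →
      (fun n => v.getD (n % v.length) 0) ∈ (betaShift β).carrier := by
    intro v hv hne
    refine mem_closure_iff_forall_agree.2 fun n => ?_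
    have hl : 0 < v.length := List.length_pos_iff.2 hne
    have hrepv : betaState β 1 (List.replicate n v).flatten = 1 := by
      induction n with
      | zero => rfl
      | succ n ih => rw [List.replicate_succ, List.flatten_cons]; exact happ hv ih
    -- The power `v^n` has state `1`, so `0` has a preimage whose expansion begins with `v^n`. These
    -- expansions approximate the periodic sequence, which need not be an expansion itself.
    obtain ⟨t, ht, -, hdig⟩ := exists_betaMap_iterate_eq hβ (List.replicate n v).flatten (c := 1)
      (t' := 0) ⟨le_rfl, by rw [hrepv]; exact one_pos⟩
    have hlen : (List.replicate n v).flatten.length = n * v.length := by simp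
    have hlt : ∀ k, ⌊β * (betaMap β)^[k] t⌋₊ < ⌈β⌉₊ + 1 := fun k => by
      have hk := betaMap_iterate_mem (β := β) ht k
      have : ⌊β * (betaMap β)^[k] t⌋₊ ≤ ⌈β⌉₊ :=
        (Nat.floor_mono (by nlinarith [hk.2])).trans (Nat.floor_le_ceil β)
      omega
    refine ⟨fun k => ⟨_, hlt k⟩, ⟨t, ht, fun k => rfl⟩, fun i hi => Fin.ext ?_⟩
    have hi' : i < n * v.length := hi.trans_le (Nat.le_mul_of_pos_right _ hl)
    rw [← getD_flatten_replicate v 0 hi', List.getD_eq_getElem _ _ (by omega)]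
    exact (hdig i (by omega)).symm
  { zero := 0
    G := {v | betaState β 1 v = 1}
    s := quasiGreedy β
    nil_mem := rfl
    append_mem := happ
    length_s := fun k => by
      induction k with
      | zero => rfl
      | succ k ih => simp [quasiGreedy, ih]
    exists_left := fun i => ⟨[], hrep i⟩
    exists_right := fun k => by
      obtain ⟨h0, h1⟩ := betaState_quasiGreedy hβ k
      -- `n` is chosen so that `β ^ n` times the state exceeds `1`; then `n` zeros restore state
      -- `1`.
      obtain ⟨n, hn⟩ := pow_unbounded_of_one_lt (betaState β 1 (quasiGreedy β k))⁻¹ hβ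
      refine ⟨List.replicate n 0, ?_⟩
      change betaState β 1 _ = 1
      rw [betaState_append]
      refine (betaState_le_one h1 _).antisymm (le_trans ?_ (le_betaState_replicate_zero hβ _ n))
      refine le_min le_rfl ?_
      rw [inv_lt_iff_one_lt_mul₀ h0] at hn
      linarith
    const_mem := by
      have := hper [0] (hrep 1) (by simp)
      simpa [Nat.mod_one] using this
    decomp := by
      intro x hx n
      obtain ⟨y, ⟨t, ht, hy⟩, hyx⟩ := mem_closure_iff_forall_agree.1 hx n
      have hxy : prefixWord x n = prefixWord y n :=
        List.map_inj_left.2 fun i hi => (hyx i (List.mem_range.1 hi)).symm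
      obtain ⟨v, k, hv, hw⟩ := exists_eq_append_quasiGreedy hβ (prefixWord y n)
        ((betaMap_iterate_mem ht n).1.trans_lt (betaMap_iterate_lt_betaState hβ ht hy n))
      exact ⟨0, v, k, hv, by rw [hxy, hw]; rfl⟩
    periodic_mem := hper }

end Beta

/-! ### S-gap shifts -/

section SGap

/-- The words `1 0^(n₁) 1 0^(n₂) … 1 0^(nₖ)` with all `nᵢ` in `S`. -/
def gapWords (S : Set ℕ) : Set (List (Fin 2)) :=
  {v | ∃ L : List ℕ, (∀ n ∈ L, n ∈ S) ∧ v = (L.map fun n => 1 :: List.replicate n 0).flatten}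

/-- The word `1 0^(k-1)` of length `k`. -/
def gapSuffix : ℕ → List (Fin 2)
  | 0 => []
  | k + 1 => 1 :: List.replicate k 0

variable {S : Set ℕ}

theorem gapWords_append {u v : List (Fin 2)} (hu : u ∈ gapWords S) (hv : v ∈ gapWords S) :
    u ++ v ∈ gapWords S := by
  obtain ⟨L, hL, rfl⟩ := hu
  obtain ⟨L', hL', rfl⟩ := hv
  refine ⟨L ++ L', fun n hn => ?_, by simp⟩
  rcases List.mem_append.1 hn with h | h
  exacts [hL n h, hL' n h]

theorem cons_replicate_mem_gapWords {n : ℕ} (hn : n ∈ S) :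
    1 :: List.replicate n 0 ∈ gapWords S := ⟨[n], by simpa using hn, by simp⟩

/-- The `1`s are exactly the block beginnings, so consecutive `1`s are separated by one of the
listed gaps. The default `0` beyond the end creates no new `1`. -/
theorem mem_of_gapWords {w : List (Fin 2)} (hw : w ∈ gapWords S) {g n : ℕ}
    (h1 : w.getD g 0 = 1) (h0 : ∀ i < n, w.getD (g + (i + 1)) 0 = 0)
    (h2 : w.getD (g + (n + 1)) 0 = 1) : n ∈ S := by
  obtain ⟨L, hL, rfl⟩ := hw
  induction L generalizing g with
  | nil => simp at h1
  | cons a L ih =>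
    have hLa := fun m hm => hL m (List.mem_cons_of_mem a hm)
    rw [List.map_cons, List.flatten_cons] at h1 h2
    simp only [List.map_cons, List.flatten_cons] at h0
    set w := (L.map fun n => (1 : Fin 2) :: List.replicate n 0).flatten with hw
    have hsmall : ∀ j, 1 ≤ j → j ≤ a → ((1 :: List.replicate a 0) ++ w).getD j (0 : Fin 2) = 0 := by
      intro j hj hja
      rw [List.getD_append _ _ _ _ (by simp; omega), List.getD_eq_getElem _ _ (by simp; omega)]
      obtain ⟨j, rfl⟩ := Nat.exists_eq_add_of_le' hj
      simp
    have hbig : ∀ j, ((1 :: List.replicate a 0) ++ w).getD (a + 1 + j) (0 : Fin 2) =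
        w.getD j 0 := by
      intro j
      rw [List.getD_append_right _ _ _ _ (by simp [add_assoc])]
      congr 1
      simp
    rcases Nat.eq_zero_or_pos g with rfl | hg
    · rcases lt_trichotomy n a with hn | rfl | hn
      · rw [hsmall _ (by omega) (by omega)] at h2
        exact absurd h2 (by decide)
      · exact hL n List.mem_cons_self
      -- Position `a + 1` starts the next block, contradicting `h0`; if there is no next block, no
      -- later `1` exists, contradicting `h2`.
      · have h3 := h0 a hn
        rw [show 0 + (a + 1) = a + 1 + 0 by omega, hbig] at h3
        cases hLc : L with
        | nil =>
          rw [show 0 + (n + 1) = a + 1 + (n - a) by omega, hbig, hw, hLc] at h2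
          simp at h2
        | cons b L' =>
          rw [hw, hLc] at h3
          simp at h3
    · rcases le_or_gt g a with hga | hga
      · rw [hsmall g hg hga] at h1
        exact absurd h1 (by decide)
      · obtain ⟨g, rfl⟩ := Nat.exists_eq_add_of_lt hga
        rw [show a + g + 1 = a + 1 + g by omega] at h1 h0 h2
        refine ih hLa (g := g) ?_ (fun i hi => ?_) ?_
        · rwa [hbig] at h1
        · have := h0 i hi
          rwa [add_assoc (a + 1), hbig] at this
        · rwa [add_assoc (a + 1), hbig] at h2

theorem prefixWord_succ {A : Type*} (x : ℕ → A) (n : ℕ) :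
    prefixWord x (n + 1) = prefixWord x n ++ [x n] := by
  simp [prefixWord, List.range_succ]

theorem getD_prefixWord {A : Type*} (x : ℕ → A) {n i : ℕ} (a : A) (h : i < n) :
    (prefixWord x n).getD i a = x i := by
  rw [List.getD_eq_getElem _ _ (by simpa [prefixWord] using h)]
  simp [prefixWord]

theorem length_gapSuffix (k : ℕ) : (gapSuffix k).length = k := by
  cases k <;> simp [gapSuffix]

/-- Reading letter by letter, a `0` lengthens the open run. A `1` closes the block `1 0^k`, where `k
∈ S` by the gap condition, and opens a new one. The suffix length `k + 1` records that a `1` has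
already occurred. -/
theorem exists_prefixWord_eq_of_mem_sGapShift {x : ℕ → Fin 2} (hx : x ∈ (sGapShift ℕ S).carrier)
    (n : ℕ) : prefixWord x n = List.replicate n 0 ∨ ∃ i v k, v ∈ gapWords S ∧
      prefixWord x n = List.replicate i 0 ++ v ++ gapSuffix (k + 1) := by
  induction n with
  | zero => exact Or.inl rfl
  | succ n ih =>
    rw [prefixWord_succ]
    have hxn : x n = 0 ∨ x n = 1 := by
      generalize x n = a
      fin_cases a <;> simp
    rcases ih with h | ⟨i, v, k, hv, h⟩
    · rcases hxn with h0 | h1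
      · left
        rw [h, h0, List.replicate_succ']
      · right
        exact ⟨n, [], 0, ⟨[], by simp, rfl⟩, by rw [h, h1]; simp [gapSuffix]⟩
    · right
      rcases hxn with h0 | h1
      · refine ⟨i, v, k + 1, hv, ?_⟩
        rw [h, h0, List.append_assoc _ (gapSuffix _)]
        simp [gapSuffix, List.replicate_succ']
      · have hlen : i + v.length + (k + 1) = n := by
          have := congrArg List.length h
          simpa [length_prefixWord, length_gapSuffix, add_assoc] using this.symm
        have hget : ∀ j < k + 1, x (i + v.length + j) = (gapSuffix (k + 1)).getD j 0 := by
          intro j hj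
          rw [← getD_prefixWord x (n := n) 0 (by omega), h, List.getD_append_right _ _ _ _
            (by simp)]
          congr 1
          simp
        have hk : k ∈ S := by
          refine hx (i + v.length) k ?_ (fun j hj => ?_) ?_
          · have := hget 0 (by omega)
            simpa [gapSuffix] using this
          · have := hget (j + 1) (by omega)
            rw [Nat.cast_id, this]
            simp [gapSuffix]
          · rw [Nat.cast_id, hlen, h1]
        refine ⟨i, v ++ gapSuffix (k + 1), 0, gapWords_append hv
          (cons_replicate_mem_gapWords hk), ?_⟩
        rw [h, h1]
        simp [gapSuffix]

/-- The one-sided `S`-gap shift is a coded shift. -/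
def codedShiftSGap (hS : S.Infinite) : CodedShift (sGapShift ℕ S) where
  zero := 0
  G := gapWords S
  s := gapSuffix
  nil_mem := ⟨[], by simp, rfl⟩
  append_mem := gapWords_append
  length_s := length_gapSuffix
  exists_left := fun i => by
    -- Since `S` is infinite, a run of zeros of any length fits into a full block `1 0^t` with `t ∈
    -- S`.
    obtain ⟨t, ht, hit⟩ := hS.exists_gt i
    refine ⟨1 :: List.replicate (t - i) 0, ?_⟩
    rw [List.cons_append, List.replicate_append_replicate, Nat.sub_add_cancel hit.le]
    exact cons_replicate_mem_gapWords ht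
  exists_right := fun k => by
    obtain ⟨t, ht, hit⟩ := hS.exists_gt k
    cases k with
    | zero => exact ⟨[], [], by simp, rfl⟩
    | succ k =>
      refine ⟨List.replicate (t - k) 0, ?_⟩
      rw [gapSuffix, List.cons_append, List.replicate_append_replicate,
        Nat.add_sub_cancel' (by omega)]
      exact cons_replicate_mem_gapWords ht
  const_mem := fun g n h1 => absurd (show (0 : Fin 2) = 1 from h1) (by decide)
  decomp := by
    intro x hx n
    rcases exists_prefixWord_eq_of_mem_sGapShift hx n with h | ⟨i, v, k, hv, h⟩
    · exact ⟨n, [], 0, ⟨[], by simp, rfl⟩, by simp [h, gapSuffix]⟩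
    · exact ⟨i, v, k + 1, hv, h⟩
  periodic_mem := by
    intro v hv hne g n h1 h0 h2
    have hl : 0 < v.length := List.length_pos_iff.2 hne
    -- As `v` is nonempty, `g + n + 2` copies reach past the last inspected position `g + n + 1`.
    have hW : (List.replicate (g + n + 2) v).flatten ∈ gapWords S := by
      generalize g + n + 2 = N
      induction N with
      | zero => exact ⟨[], by simp, rfl⟩
      | succ N ih => rw [List.replicate_succ, List.flatten_cons]; exact gapWords_append hv ih
    have hlt : ∀ j < g + n + 2, j < (g + n + 2) * v.length := fun j hj =>
      hj.trans_le (Nat.le_mul_of_pos_right _ hl)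
    refine mem_of_gapWords hW (g := g) ?_ (fun i hi => ?_) ?_
    · rw [getD_flatten_replicate _ _ (hlt _ (by omega))]
      exact h1
    · rw [getD_flatten_replicate _ _ (hlt _ (by omega))]
      exact h0 i hi
    · rw [getD_flatten_replicate _ _ (hlt _ (by omega))]
      exact h2

theorem sGapShift_int_eq_twoSided (S : Set ℕ) : sGapShift ℤ S = twoSided (sGapShift ℕ S) := by
  have h : (sGapShift ℤ S).carrier = (twoSided (sGapShift ℕ S)).carrier := by
    ext x
    refine ⟨fun hx i g n h1 h0 h2 => hx (i + g) n h1 (fun j hj => ?_) ?_, fun hx g n h1 h0 h2 => ?_⟩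
    · rw [← h0 j hj]
      push_cast
      simp only [add_assoc]
    · rw [← h2]
      push_cast
      simp only [add_assoc]
    · refine hx g 0 n (by simpa using h1) (fun j hj => ?_) ?_
      · simpa using h0 j hj
      · simpa using h2
  generalize sGapShift ℤ S = Z at h
  generalize twoSided (sGapShift ℕ S) = W at h
  cases Z
  cases W
  cases h
  rfl

end SGap

theorem theoremA :
    -- every subshift factor of a one-sided β-shift
    (∀ β : ℝ, 1 < β → ∀ (p : ℕ) (Y : Subshift (Fin p) ℕ), IsFactor (betaShift β) Y →
      IntrinsicallyErgodic (shiftMap Y) ∧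
        ∀ μ : ProbabilityMeasure Y.carrier, IsMME (shiftMap Y) μ →
          PerMeasuresConverge (shiftMap Y) μ) ∧
    -- every subshift factor of a two-sided β-shift
    (∀ β : ℝ, 1 < β → ∀ (p : ℕ) (Y : Subshift (Fin p) ℤ), IsFactor (twoSided (betaShift β)) Y →
      IntrinsicallyErgodic (shiftMap Y) ∧
        ∀ μ : ProbabilityMeasure Y.carrier, IsMME (shiftMap Y) μ →
          PerMeasuresConverge (shiftMap Y) μ) ∧
    -- every subshift factor of a two-sided S-gap shift
    (∀ S : Set ℕ, S.Infinite → ∀ (p : ℕ) (Y : Subshift (Fin p) ℤ), IsFactor (sGapShift ℤ S) Y →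
      IntrinsicallyErgodic (shiftMap Y) ∧
        ∀ μ : ProbabilityMeasure Y.carrier, IsMME (shiftMap Y) μ →
          PerMeasuresConverge (shiftMap Y) μ) ∧
    -- every subshift factor of a one-sided S-gap shift
    (∀ S : Set ℕ, S.Infinite → ∀ (p : ℕ) (Y : Subshift (Fin p) ℕ), IsFactor (sGapShift ℕ S) Y →
      IntrinsicallyErgodic (shiftMap Y) ∧
        ∀ μ : ProbabilityMeasure Y.carrier, IsMME (shiftMap Y) μ →
          PerMeasuresConverge (shiftMap Y) μ) :=
  ⟨fun _ hβ _ _ h => (codedShiftBeta hβ).intrinsicallyErgodic_factor h,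
    fun _ hβ _ _ h => (codedShiftBeta hβ).intrinsicallyErgodic_twoSided_factor h,
    fun S hS _ _ h => (codedShiftSGap hS).intrinsicallyErgodic_twoSided_factor
      (sGapShift_int_eq_twoSided S ▸ h),
    fun _ hS _ _ h => (codedShiftSGap hS).intrinsicallyErgodic_factor h⟩
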